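/- Conventions. A simplicial complex is an abstract one, every vertex being a simplex; $\mathrm{aut}(\mathbf K)$ is the group of bijections of the vertex set that preserve simplices in both directions, $|\mathbf K|$ is the geometric realization, and a path of length $m$ is a tuple $(x_0,\dots,x_m)$ of vertices (repetitions allowed) such that $\{x_{i-1},x_i\}$ is a $1$-simplex for all $1\le i\le m$. Bands. Let $m\ge 1$ and $d\ge 3$, and let $\lambda_{i,j}\ge 1$ ($1\le i\le m$, $1\le j\le d-3$) be integers such that, for each $i$, the numbers $\lambda_{i,1},\dots,\lambda_{i,d-3}$ are pairwise distinct. The band $\mathbf B_m^{d}$ is the $d$-dimensional simplicial complex consisting of - for $1\le i\le m$, a $d$-simplex $\{x_{i-1},x_i,y_i,w_i,v_{i,1},\dots,v_{i,d-3}\}$ with all its faces, where the $i$-th and $(i+1)$-st of these simplices share exactly the vertex $x_i$ and otherwise all vertices are distinct; - for $1\le i\le m$, a path with $i$ edges attached at its initial vertex to $w_i$, and for each $j$ a path with $\lambda_{i,j}$ edges attached at its initial vertex to $v_{i,j}$, all other vertices of these paths being new and distinct; - for $1\le i\le m-1$, the $2$-simplex $\{x_i,w_i,w_{i+1}\}$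 with all its faces. Rigidification. Let $\mathbf K$ be a finite simplicial complex, $G\le\mathrm{aut}(\mathbf K)$ a subgroup and $P=(x_0,\dots,x_m)$ a path of $\mathbf K$ containing all vertices of $\mathbf K$. The $G$-rigidification is $$\mathrm R_G(\mathbf K;P)=\mathbf K\cup\bigcup_{g\in G}\mathbf B_g,$$ where $\mathbf B_g$ is a copy of $\mathbf B_m^{d}$ whose vertices $x_0,\dots,x_m$ are identified, in order, with the vertices $g\cdot x_0,\dots,g\cdot x_m$ of $\mathbf K$; all other vertices of the copies $\mathbf B_g$ are new, and distinct for distinct $g$. Proposition. Let $\mathbf K$ be a finite connected $n$-dimensional simplicial complex, $G\le\mathrm{aut}(\mathbf K)$ a non-trivial subgroup, and $P=(x_0,\dots,x_m)$ a path of $\mathbf K$ containing all vertices of $\mathbf K$, with $m\ge 2$ (which is automatic if $n\ge 2$). Let $\mathrm R_G(\mathbf K;P)$ be the $G$-rigidification formed with bands of any dimension $d\ge\max(n+1,3)$ (in particular $d=n+1$ if $n\ge2$) and any numbers $\lambda_{i,j}$ as above. Then 1. $\mathrm{aut}(\mathrm R_G(\mathbf K;P))\cong G$ as groups; 2. $|\mathrm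 R_G(\mathbf K;P)|$ is homotopy equivalent to $|\mathbf K|$. -/

import Mathlib

open scoped ContinuousMap

/-! Finite abstract simplicial complexes. The vertex set of `K : AbstractSimplicialComplex V`
is the whole type `V` (every singleton is a simplex). -/

namespace AbstractSimplicialComplex

/-- The automorphism group of a simplicial complex: the bijections of the vertex set which map
simplices to simplices and whose inverses do so as well. -/
def aut {V : Type*} (K : AbstractSimplicialComplex V) : Subgroup (Equiv.Perm V) where
  carrier := {f | ∀ s : Finset V, s.map f.toEmbedding ∈ K.faces ↔ s ∈ K.faces}
  one_mem' := by
    intro s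
    have h : s.map (1 : Equiv.Perm V).toEmbedding = s := Finset.map_refl
    rw [h]
  mul_mem' := by
    intro f g hf hg s
    have h : s.map (f * g).toEmbedding = (s.map g.toEmbedding).map f.toEmbedding := by
      rw [Finset.map_map]; rfl
    rw [h, hf, hg]
  inv_mem' := by
    intro f hf s
    have h : (s.map (f⁻¹).toEmbedding).map f.toEmbedding = s := by
      have e : (f⁻¹).toEmbedding.trans f.toEmbedding = Function.Embedding.refl V := by
        ext x; exact f.apply_symm_apply x
      rw [Finset.map_map, e, Finset.map_refl]
    rw [← hf, h]

/-- `K` has dimension `n`: the largest simplices have exactly `n + 1` vertices. -/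
def HasDimension {V : Type*} (K : AbstractSimplicialComplex V) (n : ℕ) : Prop :=
  (∃ s ∈ K.faces, s.card = n + 1) ∧ ∀ s ∈ K.faces, s.card ≤ n + 1

/-- The graph formed by the vertices and the 1-simplices of `K`. -/
def oneSkeleton {V : Type*} (K : AbstractSimplicialComplex V) : SimpleGraph V where
  Adj v w := v ≠ w ∧ ∃ s ∈ K.faces, (s : Set V) = {v, w}
  symm := ⟨fun v w h => ⟨h.1.symm, by simpa only [Set.pair_comm w v] using h.2⟩⟩
  loopless := ⟨fun _ h => h.1 rfl⟩

/-- `K` is nonempty and any two vertices are joined by a path of 1-simplices. -/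
def IsConnected {V : Type*} (K : AbstractSimplicialComplex V) : Prop :=
  K.oneSkeleton.Connected

/-- `(P 0, …, P m)` is a path of length `m`: consecutive vertices span a 1-simplex
(repetitions of vertices are allowed). -/
def IsPath {V : Type*} (K : AbstractSimplicialComplex V) {m : ℕ} (P : Fin (m + 1) → V) : Prop :=
  ∀ i : Fin m, K.oneSkeleton.Adj (P i.castSucc) (P i.succ)

/-- The geometric realization of a finite simplicial complex, by barycentric coordinates, with
the subspace topology from `V → ℝ`. -/
def realization {V : Type*} (K : AbstractSimplicialComplex V) : Set (V → ℝ) :=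
  {t | (∀ v, 0 ≤ t v) ∧ ∃ s ∈ K.faces, (∀ v, v ∉ s → t v = 0) ∧ ∑ v ∈ s, t v = 1}

/-- The simplicial complex on `V` generated by a family `F` of sets of vertices: its simplices
are the singletons and the finite nonempty sets contained in a member of `F`. -/
def generatedBy {V : Type*} (F : Set (Set V)) : AbstractSimplicialComplex V where
  faces := {s | s.Nonempty ∧ ((∃ v, s = {v}) ∨ ∃ A ∈ F, (s : Set V) ⊆ A)}
  isRelLowerSet_faces := by
    rintro s ⟨hs, h⟩
    refine ⟨hs, fun t hts ht => ⟨ht, ?_⟩⟩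
    rcases h with ⟨v, rfl⟩ | ⟨A, hA, hsA⟩
    · exact Or.inl ⟨v, (Finset.subset_singleton_iff.mp hts).resolve_left ht.ne_empty⟩
    · exact Or.inr ⟨A, hA, (Finset.coe_subset.mpr hts).trans hsA⟩
  singleton_mem v := ⟨Finset.singleton_nonempty v, Or.inl ⟨v, rfl⟩⟩

theorem exists_face_image_eq {α β : Type*} (L : AbstractSimplicialComplex α) (f : α → β)
    {s t : Finset β} {a : Finset α} (ha : a ∈ L.faces) (hs : (s : Set β) = f '' (a : Set α))
    (hts : t ⊆ s) (ht : t.Nonempty) : ∃ b ∈ L.faces, (t : Set β) = f '' (b : Set α) := by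
  classical
  have hs' : s = a.image f := by
    apply Finset.coe_injective; rw [hs, Finset.coe_image]
  obtain ⟨b, hb, rfl⟩ := Finset.subset_image_iff.mp (hs' ▸ hts)
  exact ⟨b, (L.isRelLowerSet_faces ha).2 hb (Finset.image_nonempty.mp ht), Finset.coe_image⟩

end AbstractSimplicialComplex

/-- The vertices of a band other than `x_0, …, x_m`. The index `i : Fin m` numbers the blocks
from `0`, so `y i`, `w i`, … are `y_{i+1}`, `w_{i+1}`, …. A block has `c` vertices `v i j`.
The `u i k` are the further vertices of the path attached at `w i`, and the `t i j k` those of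
the path attached at `v i j`, which has `len i j` edges. -/
inductive BandInner (m c : ℕ) (len : Fin m → Fin c → ℕ) : Type
  | y (i : Fin m)
  | w (i : Fin m)
  | v (i : Fin m) (j : Fin c)
  | u (i : Fin m) (k : Fin ((i : ℕ) + 1))
  | t (i : Fin m) (j : Fin c) (k : Fin (len i j))

namespace Band

variable {m c : ℕ} {len : Fin m → Fin c → ℕ}

/-- The vertices of a band: `x_0, …, x_m` and the other ones. -/
abbrev Vertex (m c : ℕ) (len : Fin m → Fin c → ℕ) : Type := Fin (m + 1) ⊕ BandInner m c len

/-- The vertices of the big simplex of the block `i`. -/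
def block (i : Fin m) : Set (Vertex m c len) :=
  {.inl i.castSucc, .inl i.succ, .inr (.y i), .inr (.w i)} ∪ Set.range fun j => .inr (.v i j)

/-- The path attached at `w i` (that is, at `w_{i+1}`); it has `i + 1` edges. -/
def wPath (i : Fin m) : Fin ((i : ℕ) + 1 + 1) → Vertex m c len :=
  Fin.cons (.inr (.w i)) fun k => .inr (.u i k)

/-- The path attached at `v i j`; it has `len i j` edges. -/
def vPath (i : Fin m) (j : Fin c) : Fin (len i j + 1) → Vertex m c len :=
  Fin.cons (.inr (.v i j)) fun k => .inr (.t i j k)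

end Band

open AbstractSimplicialComplex in
/-- The band with `m` blocks, each of them a simplex of dimension `c + 3` on the vertices
`x_{i-1}, x_i, y_i, w_i, v_{i,1}, …, v_{i,c}` with a path of length `i` attached at `w_i` and a
path of length `len i j` attached at each `v_{i,j}`. Consecutive blocks share the vertex `x_i`
and are connected by the 2-simplex `{x_i, w_i, w_{i+1}}`. -/
def band (m c : ℕ) (len : Fin m → Fin c → ℕ) : AbstractSimplicialComplex (Band.Vertex m c len) :=
  generatedBy <|
    {A | ∃ i : Fin m, A = Band.block i} ∪
    {A | ∃ (i : Fin m) (k : Fin ((i : ℕ) + 1)),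
      A = {Band.wPath i k.castSucc, Band.wPath i k.succ}} ∪
    {A | ∃ (i : Fin m) (j : Fin c) (k : Fin (len i j)),
      A = {Band.vPath i j k.castSucc, Band.vPath i j k.succ}} ∪
    {A | ∃ i i' : Fin m, (i : ℕ) + 1 = i' ∧ A = {.inl i.succ, .inr (.w i), .inr (.w i')}}

section Rigidification

variable {V : Type*} (K : AbstractSimplicialComplex V) (G : Subgroup K.aut)
  {m : ℕ} (P : Fin (m + 1) → V) {c : ℕ} (len : Fin m → Fin c → ℕ)

/-- The vertices of the rigidification: those of `K` and, for each `g ∈ G`, a copy of the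
vertices of the band other than `x_0, …, x_m`. -/
abbrev RigidVertex : Type _ := V ⊕ (G × BandInner m c len)

/-- The map from the vertices of the band to the rigidification for the copy with index `g`:
`x_k` is identified with `g • P k`. -/
def rigidGlue (g : G) : Band.Vertex m c len → RigidVertex K G len :=
  Sum.map (fun k => ((g : K.aut) : Equiv.Perm V) (P k)) (fun b => (g, b))

/-- The `G`-rigidification of `K` with respect to `P`: the union of `K` and, for every `g ∈ G`,
a copy of the band glued along the path `g • P`. -/
def rigidification : AbstractSimplicialComplex (RigidVertex K G len) where
  faces := {s | (∃ a ∈ K.faces, (s : Set (RigidVertex K G len)) = Sum.inl '' (a : Set V)) ∨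
    ∃ g : G, ∃ a ∈ (band m c len).faces,
      (s : Set (RigidVertex K G len)) = rigidGlue K G P len g '' (a : Set (Band.Vertex m c len))}
  isRelLowerSet_faces := by
    intro s hs
    refine ⟨?_, fun t hts ht => ?_⟩
    · rcases hs with ⟨a, ha, hsa⟩ | ⟨g, a, ha, hsa⟩
      · rw [← Finset.coe_nonempty, hsa]
        exact (Finset.coe_nonempty.mpr (K.isRelLowerSet_faces ha).1).image _
      · rw [← Finset.coe_nonempty, hsa]
        exact (Finset.coe_nonempty.mpr ((band m c len).isRelLowerSet_faces ha).1).image _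
    · rcases hs with ⟨a, ha, hsa⟩ | ⟨g, a, ha, hsa⟩
      · exact Or.inl (K.exists_face_image_eq _ ha hsa hts ht)
      · exact Or.inr ⟨g, (band m c len).exists_face_image_eq _ ha hsa hts ht⟩
  singleton_mem := by
    rintro (v | ⟨g, b⟩)
    · exact Or.inl ⟨{v}, K.singleton_mem v, by simp⟩
    · exact Or.inr ⟨g, {.inr b}, (band m c len).singleton_mem _, by simp [rigidGlue]⟩

end Rigidification

/-! Homotopy type: each band deforms onto its path. If the images of every simplex under two
simplicial maps lie in a common simplex, the maps are contiguous and straight segments give a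
homotopy of realizations. A chain of contiguous maps joins the identity to the retraction onto `K`:
`clip` shortens the attached paths edge by edge, `slide P 0` gathers the inner vertices of each
block at its `w`, and these are pushed onto the path one block number at a time
(`contiguityClass_id_slide`).

Automorphisms: `Near` alone distinguishes the kinds of vertices. The `y` are the vertices with at
least two neighbours whose neighbourhood is a clique. The vertices of `K` are those near several
`y`, because `G` is nontrivial and every translate of `P` covers `K`. Among the new vertices of a
block, the triangles single out `w`. So an automorphism `f` permutes the blocks, and the lengths of
the attached paths make it preserve block numbers and labels; adjacent `w` keep each copy together
(`aut_copy`). The triangles fix the images of the interior path vertices, and injectivity those of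
the ends (`aut_path`), so copy `g` goes to copy `φ g` with `f (g • P k) = φ g • P k`. As `P` is
surjective, the case `g = 1` shows that `f` is `φ 1` on `K`, and then `φ g = φ 1 * g`. Hence `f` is
the action of `φ 1` (`actHom_surjective`). -/

namespace AbstractSimplicialComplex

/-- The set `A` of vertices is contained in a simplex of `K`. -/
def Spans {V : Type*} (K : AbstractSimplicialComplex V) (A : Set V) : Prop :=
  ∃ s ∈ K.faces, A ⊆ (s : Set V)

theorem Spans.mono {V : Type*} {K : AbstractSimplicialComplex V} {A B : Set V} (h : K.Spans B)
    (hAB : A ⊆ B) : K.Spans A :=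
  let ⟨s, hs, hB⟩ := h
  ⟨s, hs, hAB.trans hB⟩

theorem spans_of_mem_faces {V : Type*} {K : AbstractSimplicialComplex V} {s : Finset V}
    (hs : s ∈ K.faces) : K.Spans s :=
  ⟨s, hs, subset_rfl⟩

theorem aut_spans {V : Type*} {K : AbstractSimplicialComplex V} (g : K.aut) {A : Set V}
    (h : K.Spans A) : K.Spans ((g : Equiv.Perm V) '' A) := by
  obtain ⟨s, hs, hA⟩ := h
  exact ⟨s.map (g : Equiv.Perm V).toEmbedding, (g.2 s).mpr hs, by simpa using hA⟩

/-! ### Contiguous simplicial maps and homotopies of realizations. -/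

section Realization

variable {U V W : Type*} [Fintype U] [Fintype V] [Fintype W]
  {L : AbstractSimplicialComplex U} {K : AbstractSimplicialComplex V}
  {M : AbstractSimplicialComplex W}

/-- Summing over all vertices frees the description from a chosen simplex; only the support has to
be controlled. -/
theorem mem_realization_iff {t : V → ℝ} : t ∈ K.realization ↔
    (∀ v, 0 ≤ t v) ∧ ∑ v, t v = 1 ∧ K.Spans {v | t v ≠ 0} := by
  refine and_congr_right fun _ => ⟨?_, ?_⟩
  · rintro ⟨s, hs, h0, h1⟩
    refine ⟨?_, s, hs, fun v hv => by_contra fun h => hv (h0 v h)⟩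
    rw [← h1]
    exact (Finset.sum_subset (Finset.subset_univ s) fun v _ hv => h0 v hv).symm
  · rintro ⟨h1, s, hs, h0⟩
    have h : ∀ v, v ∉ s → t v = 0 := fun v hv => by_contra fun h => hv (h0 h)
    refine ⟨s, hs, h, ?_⟩
    rw [← h1]
    exact Finset.sum_subset (Finset.subset_univ s) fun v _ hv => h v hv

open Classical in
/-- The linear map on barycentric coordinates induced by a map of vertices. -/
noncomputable def push (f : V → W) (t : V → ℝ) (w : W) : ℝ :=
  ∑ v, if f v = w then t v else 0

omit [Fintype W] in
theorem push_nonneg (f : V → W) {t : V → ℝ} (ht : ∀ v, 0 ≤ t v) (w : W) : 0 ≤ push f t w :=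
  Finset.sum_nonneg fun v _ => by split_ifs <;> simp [ht]

theorem sum_push (f : V → W) (t : V → ℝ) : ∑ w, push f t w = ∑ v, t v := by
  classical
  simp only [push]
  rw [Finset.sum_comm]
  simp

omit [Fintype W] in
theorem push_support (f : V → W) (t : V → ℝ) :
    {w | push f t w ≠ 0} ⊆ f '' {v | t v ≠ 0} := by
  intro w hw
  obtain ⟨v, -, hv⟩ := Finset.exists_ne_zero_of_sum_ne_zero hw
  split_ifs at hv with h
  · exact ⟨v, hv, h⟩
  · exact (hv rfl).elim

theorem push_id (t : V → ℝ) : push id t = t := by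
  classical
  funext v
  simp [push]

omit [Fintype W] in
theorem push_push (f : U → V) (g : V → W) (t : U → ℝ) : push g (push f t) = push (g ∘ f) t := by
  classical
  funext w
  simp only [push, Function.comp]
  have h : ∀ v, (if g v = w then ∑ u, (if f u = v then t u else 0) else 0)
      = ∑ u, if f u = v then (if g v = w then t u else 0) else 0 := by
    intro v
    by_cases hv : g v = w <;> simp [hv]
  simp_rw [h]
  rw [Finset.sum_comm]
  simp

omit [Fintype W] in
theorem continuous_push (f : V → W) : Continuous (push f) := by
  classical
  refine continuous_pi fun w => continuous_finsetSum _ fun v _ => ?_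
  split_ifs <;> fun_prop

variable (K M) in
/-- Two maps of vertices are contiguous if for every simplex the union of its images is contained
in a simplex. -/
def Contiguous (f g : V → W) : Prop :=
  ∀ s ∈ K.faces, M.Spans (f '' s ∪ g '' s)

omit [Fintype V] [Fintype W] in
theorem Contiguous.symm {f g : V → W} (h : Contiguous K M f g) : Contiguous K M g f :=
  fun s hs => Set.union_comm _ _ ▸ h s hs

omit [Fintype V] [Fintype W] in
theorem Contiguous.left {f g : V → W} (h : Contiguous K M f g) : Contiguous K M f f :=
  fun s hs => (h s hs).mono (by simp)

/-- The support of the combination lies in the union of the two images of a simplex carrying `t`,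
which contiguity places in one simplex. -/
theorem combo_mem_realization {f g : V → W} (h : Contiguous K M f g) {t : V → ℝ}
    (ht : t ∈ K.realization) {a : ℝ} (ha : a ∈ unitInterval) :
    (fun w => (1 - a) * push f t w + a * push g t w) ∈ M.realization := by
  obtain ⟨h0, h1, s, hs, hsupp⟩ := mem_realization_iff.mp ht
  have ha' : 0 ≤ 1 - a := sub_nonneg.mpr ha.2
  refine mem_realization_iff.mpr ⟨fun w => ?_, ?_, (h s hs).mono fun w hw => ?_⟩
  · exact add_nonneg (mul_nonneg ha' (push_nonneg f h0 w)) (mul_nonneg ha.1 (push_nonneg g h0 w))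
  · rw [Finset.sum_add_distrib, ← Finset.mul_sum, ← Finset.mul_sum, sum_push, sum_push, h1]
    ring
  · by_cases hf : push f t w = 0
    · have hg : push g t w ≠ 0 := fun hg => hw (by simp [hf, hg])
      exact Or.inr (Set.image_mono hsupp (push_support g t hg))
    · exact Or.inl (Set.image_mono hsupp (push_support f t hf))

theorem push_mem_realization {f : V → W} (h : Contiguous K M f f) {t : V → ℝ}
    (ht : t ∈ K.realization) : push f t ∈ M.realization := by
  simpa using combo_mem_realization h ht unitInterval.zero_mem

/-- The continuous map of realizations induced by a simplicial map. -/
noncomputable def realizationMap (f : V → W) (h : Contiguous K M f f) :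
    C(K.realization, M.realization) where
  toFun t := ⟨push f t, push_mem_realization h t.2⟩
  continuous_toFun := by
    have := continuous_push f
    fun_prop

/-- The straight-line homotopy between contiguous maps. -/
theorem Contiguous.homotopic {f g : V → W} (h : Contiguous K M f g) :
    (realizationMap f h.left).Homotopic (realizationMap g h.symm.left) := by
  refine ⟨⟨⟨fun p => ⟨fun w => (1 - (p.1 : ℝ)) * push f p.2 w + p.1 * push g p.2 w,
    combo_mem_realization h p.2.2 p.1.2⟩, ?_⟩, fun t => ?_, fun t => ?_⟩⟩
  · refine Continuous.subtype_mk (continuous_pi fun w => ?_) _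
    have hf : Continuous fun t => push f t w := (continuous_apply w).comp (continuous_push f)
    have hg : Continuous fun t => push g t w := (continuous_apply w).comp (continuous_push g)
    fun_prop
  · ext w; simp [realizationMap]
  · ext w; simp [realizationMap]

/-- The equivalence relation generated by contiguity. -/
def ContiguityClass (K : AbstractSimplicialComplex V) (M : AbstractSimplicialComplex W)
    (f g : V → W) : Prop :=
  Relation.ReflTransGen (Contiguous K M) f g

theorem ContiguityClass.homotopic {f g : V → W} (h : ContiguityClass K M f g)
    (hf : Contiguous K M f f) :
    ∃ hg : Contiguous K M g g, (realizationMap f hf).Homotopic (realizationMap g hg) := by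
  induction h with
  | refl => exact ⟨hf, .refl _⟩
  | tail _ h ih =>
    obtain ⟨_, ih⟩ := ih
    exact ⟨h.symm.left, ih.trans h.homotopic⟩

/-- A simplicial retraction in the contiguity class of the identity is a homotopy equivalence. -/
theorem homotopyEquiv_of_contiguityClass {r : V → W} {i : W → V} (hr : Contiguous K M r r)
    (hi : Contiguous M K i i) (hri : r ∘ i = id) (hir : ContiguityClass K K id (i ∘ r)) :
    Nonempty (K.realization ≃ₕ M.realization) := by
  have hid : Contiguous K K id id := fun s hs => by simpa using spans_of_mem_faces hs
  obtain ⟨_, H⟩ := hir.homotopic hid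
  refine ⟨⟨realizationMap r hr, realizationMap i hi, ?_, ?_⟩⟩
  · convert H.symm using 1
    · ext t : 2
      exact push_push r i t.1
    · ext t : 2
      exact (push_id t.1).symm
  · convert ContinuousMap.Homotopic.refl _ using 1
    ext t : 2
    change t.1 = push r (push i t.1)
    rw [push_push, hri, push_id]

end Realization

end AbstractSimplicialComplex

/-! ### Generating simplices of the rigidification. -/

open AbstractSimplicialComplex

instance BandInner.finite {m c : ℕ} {len : Fin m → Fin c → ℕ} : Finite (BandInner m c len) := by
  let T := Fin m ⊕ Fin m ⊕ (Fin m × Fin c) ⊕ (Σ i : Fin m, Fin ((i : ℕ) + 1)) ⊕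
    (Σ p : Fin m × Fin c, Fin (len p.1 p.2))
  let f : T → BandInner m c len
    | .inl i => .y i
    | .inr (.inl i) => .w i
    | .inr (.inr (.inl p)) => .v p.1 p.2
    | .inr (.inr (.inr (.inl p))) => .u p.1 p.2
    | .inr (.inr (.inr (.inr p))) => .t p.1.1 p.1.2 p.2
  refine Finite.of_surjective f ?_
  rintro (i | i | ⟨i, j⟩ | ⟨i, k⟩ | ⟨i, j, k⟩)
  · exact ⟨.inl i, rfl⟩
  · exact ⟨.inr (.inl i), rfl⟩
  · exact ⟨.inr (.inr (.inl (i, j))), rfl⟩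
  · exact ⟨.inr (.inr (.inr (.inl ⟨i, k⟩))), rfl⟩
  · exact ⟨.inr (.inr (.inr (.inr ⟨(i, j), k⟩))), rfl⟩

/-- The number of the block to which a vertex of the band belongs. -/
def BandInner.idx {m c : ℕ} {len : Fin m → Fin c → ℕ} : BandInner m c len → Fin m
  | .y i => i
  | .w i => i
  | .v i _ => i
  | .u i _ => i
  | .t i _ _ => i

namespace Rigid

variable {V : Type*} (K : AbstractSimplicialComplex V) (G : Subgroup K.aut)
  {m : ℕ} (P : Fin (m + 1) → V) {c : ℕ} (len : Fin m → Fin c → ℕ)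

/-- The vertex `g • P k`. -/
abbrev xv (g : G) (k : Fin (m + 1)) : RigidVertex K G len :=
  .inl (((g : K.aut) : Equiv.Perm V) (P k))

/-- The vertices of the big simplex of block `i` of the copy `g`. -/
def blk (g : G) (i : Fin m) : Set (RigidVertex K G len) :=
  {xv K G P len g i.castSucc, xv K G P len g i.succ, .inr (g, .y i), .inr (g, .w i)} ∪
    Set.range fun j => .inr (g, .v i j)

/-- The path attached at `w i`, constant from its end on. -/
def uPath (g : G) (i : Fin m) : ℕ → RigidVertex K G len
  | 0 => .inr (g, .w i)
  | k + 1 => if h : k < i + 1 then .inr (g, .u i ⟨k, h⟩) else .inr (g, .w i)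

/-- The path attached at `v i j`, constant from its end on. -/
def tPath (g : G) (i : Fin m) (j : Fin c) : ℕ → RigidVertex K G len
  | 0 => .inr (g, .v i j)
  | k + 1 => if h : k < len i j then .inr (g, .t i j ⟨k, h⟩) else .inr (g, .v i j)

theorem uPath_zero (g : G) (i : Fin m) : uPath K G len g i 0 = .inr (g, .w i) := rfl

theorem tPath_zero (g : G) (i : Fin m) (j : Fin c) :
    tPath K G len g i j 0 = .inr (g, .v i j) := rfl

theorem uPath_succ (g : G) (i : Fin m) (k : Fin ((i : ℕ) + 1)) :
    uPath K G len g i (k + 1) = .inr (g, .u i k) :=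
  dif_pos k.2

theorem tPath_succ (g : G) (i : Fin m) (j : Fin c) (k : Fin (len i j)) :
    tPath K G len g i j (k + 1) = .inr (g, .t i j k) :=
  dif_pos k.2

theorem glue_block (g : G) (i : Fin m) :
    rigidGlue K G P len g '' Band.block i = blk K G P len g i := by
  rw [Band.block, blk, Set.image_union, ← Set.range_comp]
  simp only [Set.image_insert_eq, Set.image_singleton]
  rfl

theorem glue_wPath (g : G) (i : Fin m) (k : Fin ((i : ℕ) + 1 + 1)) :
    rigidGlue K G P len g (Band.wPath i k) = uPath K G len g i k := by
  refine Fin.cases rfl (fun k => ?_) k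
  rw [Fin.val_succ, uPath_succ]
  rfl

theorem glue_vPath (g : G) (i : Fin m) (j : Fin c) (k : Fin (len i j + 1)) :
    rigidGlue K G P len g (Band.vPath i j k) = tPath K G len g i j k := by
  refine Fin.cases rfl (fun k => ?_) k
  rw [Fin.val_succ, tPath_succ]
  rfl

/-- The sets of vertices which, together with the simplices of `K`, generate the rigidification. -/
inductive Gen : Set (RigidVertex K G len) → Prop
  | block (g : G) (i : Fin m) : Gen (blk K G P len g i)
  | uEdge (g : G) (i : Fin m) (k : ℕ) (hk : k < i + 1) :
      Gen {uPath K G len g i k, uPath K G len g i (k + 1)}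
  | tEdge (g : G) (i : Fin m) (j : Fin c) (k : ℕ) (hk : k < len i j) :
      Gen {tPath K G len g i j k, tPath K G len g i j (k + 1)}
  | triangle (g : G) (i i' : Fin m) (h : (i : ℕ) + 1 = i') :
      Gen {xv K G P len g i.succ, .inr (g, .w i), .inr (g, .w i')}

variable {K G P len}

/-- Puts the singletons of a band, which are faces by convention, under the generators. -/
theorem exists_gen (g : G) (b : BandInner m c len) :
    ∃ A, Gen K G P len A ∧ Sum.inr (g, b) ∈ A := by
  rcases b with i | i | ⟨i, j⟩ | ⟨i, k⟩ | ⟨i, j, k⟩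
  · exact ⟨_, .block g i, by simp [blk]⟩
  · exact ⟨_, .block g i, by simp [blk]⟩
  · exact ⟨_, .block g i, by simp [blk]⟩
  · exact ⟨_, .uEdge g i k k.2, by simp [uPath_succ]⟩
  · exact ⟨_, .tEdge g i j k k.2, by simp [tPath_succ]⟩

theorem face_cases {s : Finset (RigidVertex K G len)} (hs : s ∈ (rigidification K G P len).faces) :
    (∃ a ∈ K.faces, (s : Set (RigidVertex K G len)) = Sum.inl '' (a : Set V)) ∨
      ∃ A, Gen K G P len A ∧ (s : Set (RigidVertex K G len)) ⊆ A := by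
  rcases hs with h | ⟨g, a, ha, hsa⟩
  · exact .inl h
  obtain ⟨-, ⟨x | b, rfl⟩ | ⟨A, hA, haA⟩⟩ := ha
  · exact .inl ⟨_, K.singleton_mem (((g : K.aut) : Equiv.Perm V) (P x)), by simp [hsa, rigidGlue]⟩
  · obtain ⟨A, hA, hb⟩ := exists_gen (P := P) g b
    exact .inr ⟨A, hA, by simpa [hsa, rigidGlue] using hb⟩
  · refine .inr ⟨rigidGlue K G P len g '' A, ?_, hsa ▸ Set.image_mono haA⟩
    rcases hA with ((⟨i, rfl⟩ | ⟨i, k, rfl⟩) | ⟨i, j, k, rfl⟩) | ⟨i, i', h, rfl⟩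
    · rw [glue_block]; exact .block g i
    · rw [Set.image_pair, glue_wPath, glue_wPath]; exact .uEdge g i k k.2
    · rw [Set.image_pair, glue_vPath, glue_vPath]; exact .tEdge g i j k k.2
    · simp only [Set.image_insert_eq, Set.image_singleton]; exact .triangle g i i' h

theorem spans_inl {A : Set V} (h : K.Spans A) :
    (rigidification K G P len).Spans (Sum.inl '' A) := by
  obtain ⟨a, ha, hA⟩ := h
  exact ⟨a.map .inl, .inl ⟨a, ha, by simp⟩, by simpa using Set.image_mono hA⟩

theorem Gen.spans {A : Set (RigidVertex K G len)} (h : Gen K G P len A) :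
    (rigidification K G P len).Spans A := by
  classical
  have key : ∀ (g : G) (B : Set (Band.Vertex m c len)), B.Nonempty → (∃ A ∈
    {A | ∃ i : Fin m, A = Band.block i} ∪
    {A | ∃ (i : Fin m) (k : Fin ((i : ℕ) + 1)),
      A = {Band.wPath i k.castSucc, Band.wPath i k.succ}} ∪
    {A | ∃ (i : Fin m) (j : Fin c) (k : Fin (len i j)),
      A = {Band.vPath i j k.castSucc, Band.vPath i j k.succ}} ∪
    {A | ∃ i i' : Fin m, (i : ℕ) + 1 = i' ∧ A = {.inl i.succ, .inr (.w i), .inr (.w i')}},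
      B ⊆ A) → (rigidification K G P len).Spans (rigidGlue K G P len g '' B) := by
    intro g B hB h
    have hfin : B.Finite := B.toFinite
    lift B to Finset (Band.Vertex m c len) using hfin
    refine ⟨B.image (rigidGlue K G P len g), .inr ⟨g, B, ⟨Finset.coe_nonempty.mp hB, .inr h⟩,
      by simp⟩, by simp⟩
  cases h with
  | block g i =>
    rw [← glue_block]
    exact key g _ ⟨_, .inl (.inl rfl)⟩ ⟨_, .inl (.inl (.inl ⟨i, rfl⟩)), subset_rfl⟩
  | uEdge g i k hk =>
    have := key g {Band.wPath i (Fin.castSucc ⟨k, hk⟩), Band.wPath i (Fin.succ ⟨k, hk⟩)}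
      ⟨_, .inl rfl⟩ ⟨_, .inl (.inl (.inr ⟨i, ⟨k, hk⟩, rfl⟩)), subset_rfl⟩
    rwa [Set.image_pair, glue_wPath, glue_wPath] at this
  | tEdge g i j k hk =>
    have := key g {Band.vPath i j (Fin.castSucc ⟨k, hk⟩), Band.vPath i j (Fin.succ ⟨k, hk⟩)}
      ⟨_, .inl rfl⟩ ⟨_, .inl (.inr ⟨i, j, ⟨k, hk⟩, rfl⟩), subset_rfl⟩
    rwa [Set.image_pair, glue_vPath, glue_vPath] at this
  | triangle g i i' h =>
    have := key g {.inl i.succ, .inr (.w i), .inr (.w i')} ⟨_, .inl rfl⟩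
      ⟨_, .inr ⟨i, i', h, rfl⟩, subset_rfl⟩
    simp only [Set.image_insert_eq, Set.image_singleton] at this
    exact this

end Rigid

/-! ### Deformation of the rigidification onto `K`. -/

namespace Rigid

variable {V : Type*} {K : AbstractSimplicialComplex V} {G : Subgroup K.aut}
  {m : ℕ} {P : Fin (m + 1) → V} {c : ℕ} {len : Fin m → Fin c → ℕ}

/-- Simplices of `K` stay fixed, so only the generators have to be tested. -/
theorem contiguous_of_gen {f h : RigidVertex K G len → RigidVertex K G len}
    (hf : ∀ v, f (.inl v) = .inl v) (hh : ∀ v, h (.inl v) = .inl v)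
    (H : ∀ A, Gen K G P len A → (rigidification K G P len).Spans (f '' A ∪ h '' A)) :
    Contiguous (rigidification K G P len) (rigidification K G P len) f h := by
  intro s hs
  rcases face_cases hs with ⟨a, ha, hsa⟩ | ⟨A, hA, hsA⟩
  · refine (spans_inl (spans_of_mem_faces ha)).mono ?_
    rw [hsa, Set.image_image, Set.image_image]
    simp [hf, hh]
  · exact (H A hA).mono (Set.union_subset_union (Set.image_mono hsA) (Set.image_mono hsA))

/-- Shorten all attached paths to length `s`. -/
def clip (s : ℕ) : RigidVertex K G len → RigidVertex K G len
  | .inl x => .inl x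
  | .inr (g, .y i) => .inr (g, .y i)
  | .inr (g, .w i) => .inr (g, .w i)
  | .inr (g, .v i j) => .inr (g, .v i j)
  | .inr (g, .u i k) => uPath K G len g i (min (k + 1) s)
  | .inr (g, .t i j k) => tPath K G len g i j (min (k + 1) s)

theorem clip_uPath (s : ℕ) (g : G) (i : Fin m) {k : ℕ} (hk : k ≤ i + 1) :
    clip s (uPath K G len g i k) = uPath K G len g i (min k s) := by
  cases k with
  | zero => simp [uPath_zero, clip]
  | succ k => rw [uPath_succ (k := ⟨k, hk⟩)]; rfl

theorem clip_tPath (s : ℕ) (g : G) (i : Fin m) (j : Fin c) {k : ℕ} (hk : k ≤ len i j) :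
    clip s (tPath K G len g i j k) = tPath K G len g i j (min k s) := by
  cases k with
  | zero => simp [tPath_zero, clip]
  | succ k => rw [tPath_succ (k := ⟨k, hk⟩)]; rfl

/-- For `k < s` the four values are among `k` and `k + 1`, otherwise among `s` and `s + 1`; in both
cases the smaller one is `min k s`. -/
theorem exists_clip_edge {k s n : ℕ} (hk : k < n) :
    ∃ l < n, ∀ z, (z = min k s ∨ z = min (k + 1) s ∨ z = min k (s + 1) ∨ z = min (k + 1) (s + 1)) →
      z = l ∨ z = l + 1 :=
  ⟨min k s, by omega, by omega⟩

theorem image_blk_subset {f : RigidVertex K G len → RigidVertex K G len} {g : G} {i : Fin m}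
    {B : Set (RigidVertex K G len)} (h1 : f (xv K G P len g i.castSucc) ∈ B)
    (h2 : f (xv K G P len g i.succ) ∈ B) (hy : f (.inr (g, .y i)) ∈ B)
    (hw : f (.inr (g, .w i)) ∈ B) (hv : ∀ j, f (.inr (g, .v i j)) ∈ B) :
    f '' blk K G P len g i ⊆ B := by
  rintro _ ⟨a, (rfl | rfl | rfl | rfl) | ⟨j, rfl⟩, rfl⟩ <;> simp_all

/-- An edge of an attached path has all its images under both maps on a single edge of that path;
blocks and triangles do not move. -/
theorem contiguous_clip (s : ℕ) : Contiguous (rigidification K G P len)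
    (rigidification K G P len) (clip (s + 1)) (clip s) := by
  refine contiguous_of_gen (fun _ => rfl) (fun _ => rfl) fun A hA => ?_
  have hA' := hA
  cases hA with
  | block g i =>
    refine hA'.spans.mono (Set.union_subset ?_ ?_) <;>
      exact image_blk_subset (by simp [clip, blk]) (by simp [clip, blk]) (by simp [clip, blk])
        (by simp [clip, blk]) (by simp [clip, blk])
  | uEdge g i k hk =>
    obtain ⟨l, hl, h⟩ := exists_clip_edge (s := s) hk
    refine (Gen.uEdge g i l hl).spans.mono ?_
    simp only [Set.image_pair, clip_uPath _ _ _ hk.le, clip_uPath _ _ _ (Nat.succ_le_of_lt hk)]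
    have key : ∀ z, (z = l ∨ z = l + 1) →
        uPath K G len g i z ∈ ({uPath K G len g i l, uPath K G len g i (l + 1)} : Set _) := by
      rintro z (rfl | rfl) <;> simp
    rintro _ ((rfl | rfl) | (rfl | rfl)) <;> exact key _ (h _ (by simp))
  | tEdge g i j k hk =>
    obtain ⟨l, hl, h⟩ := exists_clip_edge (s := s) hk
    refine (Gen.tEdge g i j l hl).spans.mono ?_
    simp only [Set.image_pair, clip_tPath _ _ _ _ hk.le, clip_tPath _ _ _ _ (Nat.succ_le_of_lt hk)]
    have key : ∀ z, (z = l ∨ z = l + 1) →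
        tPath K G len g i j z ∈ ({tPath K G len g i j l, tPath K G len g i j (l + 1)} : Set _) := by
      rintro z (rfl | rfl) <;> simp
    rintro _ ((rfl | rfl) | (rfl | rfl)) <;> exact key _ (h _ (by simp))
  | triangle g i i' h =>
    refine hA'.spans.mono ?_
    simp [clip, Set.image_insert_eq]

theorem clip_eq_id {N : ℕ} (hm : m ≤ N) (hN : ∀ i j, len i j ≤ N) :
    clip N = (id : RigidVertex K G len → RigidVertex K G len) := by
  funext a
  rcases a with x | ⟨g, i | i | ⟨i, j⟩ | ⟨i, k⟩ | ⟨i, j, k⟩⟩ <;> try rfl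
  · rw [clip, min_eq_left (by omega), uPath_succ]; rfl
  · rw [clip, min_eq_left (k.2.trans_le (hN i j)), tPath_succ]; rfl

variable (P) in
/-- Move everything in the first `s` blocks to the second vertex on the path `P`, and everything
in the other blocks to `w`. -/
def slide (s : ℕ) : RigidVertex K G len → RigidVertex K G len
  | .inl x => .inl x
  | .inr (g, b) => if (b.idx : ℕ) < s then xv K G P len g b.idx.succ else .inr (g, .w b.idx)

theorem slide_inr_mem_blk (s : ℕ) (g : G) (b : BandInner m c len) :
    slide P s (.inr (g, b)) ∈ blk K G P len g b.idx := by
  simp only [slide]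
  split_ifs <;> simp [blk]

theorem slide_image_blk (s : ℕ) (g : G) (i : Fin m) :
    slide P s '' blk K G P len g i ⊆ blk K G P len g i :=
  image_blk_subset (by simp [slide, blk]) (by simp [slide, blk]) (slide_inr_mem_blk s g (.y i))
    (slide_inr_mem_blk s g (.w i)) fun j => slide_inr_mem_blk s g (.v i j)

/-- No bound on `k` is required: the default value past the end is again an inner vertex of block
`i`. -/
theorem uPath_eq_inr (g : G) (i : Fin m) (k : ℕ) :
    ∃ b : BandInner m c len, b.idx = i ∧ uPath K G len g i k = .inr (g, b) := by
  cases k with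
  | zero => exact ⟨.w i, rfl, rfl⟩
  | succ k =>
    rw [uPath]
    split_ifs with h
    exacts [⟨.u i ⟨k, h⟩, rfl, rfl⟩, ⟨.w i, rfl, rfl⟩]

theorem tPath_eq_inr (g : G) (i : Fin m) (j : Fin c) (k : ℕ) :
    ∃ b : BandInner m c len, b.idx = i ∧ tPath K G len g i j k = .inr (g, b) := by
  cases k with
  | zero => exact ⟨.v i j, rfl, rfl⟩
  | succ k =>
    rw [tPath]
    split_ifs with h
    exacts [⟨.t i j ⟨k, h⟩, rfl, rfl⟩, ⟨.v i j, rfl, rfl⟩]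

theorem slide_uPath_mem_blk (s : ℕ) (g : G) (i : Fin m) (k : ℕ) :
    slide P s (uPath K G len g i k) ∈ blk K G P len g i := by
  obtain ⟨b, rfl, h⟩ := uPath_eq_inr (K := K) (len := len) g i k
  exact h ▸ slide_inr_mem_blk s g b

theorem slide_tPath_mem_blk (s : ℕ) (g : G) (i : Fin m) (j : Fin c) (k : ℕ) :
    slide P s (tPath K G len g i j k) ∈ blk K G P len g i := by
  obtain ⟨b, hb, h⟩ := tPath_eq_inr (K := K) (len := len) g i j k
  exact h ▸ hb ▸ slide_inr_mem_blk s g b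

/-- Once the attached paths are collapsed, both maps keep a block and its paths inside the block's
simplex, and both fix the triangles. -/
theorem contiguous_clip_slide : Contiguous (rigidification K G P len)
    (rigidification K G P len) (clip 0) (slide P 0) := by
  refine contiguous_of_gen (fun _ => rfl) (fun _ => rfl) fun A hA => ?_
  have hA' := hA
  cases hA with
  | block g i =>
    refine hA'.spans.mono (Set.union_subset ?_ (slide_image_blk 0 g i))
    exact image_blk_subset (by simp [clip, blk]) (by simp [clip, blk]) (by simp [clip, blk])
        (by simp [clip, blk]) (by simp [clip, blk])
  | uEdge g i k hk =>
    refine (Gen.block g i).spans.mono (Set.union_subset ?_ ?_)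
    · simp only [Set.image_pair, clip_uPath _ _ _ hk.le, clip_uPath _ _ _ (Nat.succ_le_of_lt hk)]
      simp [uPath_zero, blk]
    · rw [Set.image_pair, Set.pair_subset_iff]
      exact ⟨slide_uPath_mem_blk .., slide_uPath_mem_blk ..⟩
  | tEdge g i j k hk =>
    refine (Gen.block g i).spans.mono (Set.union_subset ?_ ?_)
    · simp only [Set.image_pair, clip_tPath _ _ _ _ hk.le,
        clip_tPath _ _ _ _ (Nat.succ_le_of_lt hk)]
      simp [tPath_zero, blk]
    · rw [Set.image_pair, Set.pair_subset_iff]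
      exact ⟨slide_tPath_mem_blk .., slide_tPath_mem_blk ..⟩
  | triangle g i i' h =>
    refine hA'.spans.mono ?_
    simp [clip, slide, Set.image_insert_eq, BandInner.idx]

/-- Moving all blocks at once would spread a triangle over `x_i, w_i, w_{i+1}, x_{i+1}`, which need
not lie in a common simplex; hence one block number per step. -/
theorem contiguous_slide (s : ℕ) : Contiguous (rigidification K G P len)
    (rigidification K G P len) (slide P s) (slide P (s + 1)) := by
  refine contiguous_of_gen (fun _ => rfl) (fun _ => rfl) fun A hA => ?_
  have hA' := hA
  cases hA with
  | block g i =>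
    exact hA'.spans.mono (Set.union_subset (slide_image_blk _ g i) (slide_image_blk _ g i))
  | uEdge g i k hk =>
    refine (Gen.block g i).spans.mono (Set.union_subset ?_ ?_) <;>
    · rw [Set.image_pair, Set.pair_subset_iff]
      exact ⟨slide_uPath_mem_blk .., slide_uPath_mem_blk ..⟩
  | tEdge g i j k hk =>
    refine (Gen.block g i).spans.mono (Set.union_subset ?_ ?_) <;>
    · rw [Set.image_pair, Set.pair_subset_iff]
      exact ⟨slide_tPath_mem_blk .., slide_tPath_mem_blk ..⟩
  | triangle g i i' h =>
    have hx : xv K G P len g i.succ = xv K G P len g i'.castSucc := by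
      congr 3; ext; simpa using h
    -- If `w i` has already reached the path, the images lie in block `i'`, which contains the
    -- shared path vertex. Otherwise `w i'` does not move yet, and the images stay in the triangle.
    by_cases hs : (i : ℕ) < s
    · refine (Gen.block g i').spans.mono (Set.union_subset ?_ ?_) <;>
      · simp only [Set.image_insert_eq, Set.image_singleton, Set.insert_subset_iff,
          Set.singleton_subset_iff]
        refine ⟨by simp [slide, hx, blk], ?_, slide_inr_mem_blk _ g (.w i')⟩
        have : (i : ℕ) < s + 1 := by omega
        simp [slide, BandInner.idx, hs, this, hx, blk]
    · have h1 : ¬ (i' : ℕ) < s := by omega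
      have h2 : ¬ (i' : ℕ) < s + 1 := by omega
      refine hA'.spans.mono (Set.union_subset ?_ ?_)
      · simp [Set.image_insert_eq, slide, BandInner.idx, hs, h1]
      · simp only [Set.image_insert_eq, Set.image_singleton, Set.insert_subset_iff,
          Set.singleton_subset_iff, slide, BandInner.idx, h2, if_false]
        refine ⟨by simp, ?_, by simp⟩
        by_cases hs' : (i : ℕ) < s + 1
        · exact .inl (if_pos hs')
        · exact .inr (.inl (if_neg hs'))

variable (P) in
/-- The retraction of the rigidification to `K`. -/
def retract : RigidVertex K G len → V
  | .inl x => x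
  | .inr (g, b) => ((g : K.aut) : Equiv.Perm V) (P b.idx.succ)

theorem inl_comp_retract :
    Sum.inl ∘ retract P = (slide P m : RigidVertex K G len → RigidVertex K G len) := by
  funext a
  rcases a with x | ⟨g, b⟩
  · rfl
  · simp [slide, retract]

theorem contiguityClass_id_slide [Finite V] : ContiguityClass (rigidification K G P len)
    (rigidification K G P len) id (slide P m) := by
  obtain ⟨N, hN⟩ : ∃ N, ∀ i j, len i j ≤ N := by
    obtain ⟨N, hN⟩ := (Set.finite_range fun p : Fin m × Fin c => len p.1 p.2).bddAbove
    exact ⟨N, fun i j => hN ⟨(i, j), rfl⟩⟩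
  have h1 : ∀ s, ContiguityClass (rigidification K G P len) (rigidification K G P len)
      (clip s) (clip 0) := by
    intro s
    induction s with
    | zero => exact .refl
    | succ s ih => exact .head (contiguous_clip s) ih
  have h2 : ∀ s, ContiguityClass (rigidification K G P len) (rigidification K G P len)
      (slide P 0) (slide P s) := by
    intro s
    induction s with
    | zero => exact .refl
    | succ s ih => exact .tail ih (contiguous_slide s)
  rw [← clip_eq_id (le_max_left m N) fun i j => (hN i j).trans (le_max_right m N)]
  exact ((h1 _).tail contiguous_clip_slide).trans (h2 m)

theorem path_spans (hP : K.IsPath P) (g : G) (i : Fin m) :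
    K.Spans {((g : K.aut) : Equiv.Perm V) (P i.castSucc),
      ((g : K.aut) : Equiv.Perm V) (P i.succ)} := by
  obtain ⟨-, s, hs, h⟩ := hP i
  rw [← Set.image_pair]
  exact aut_spans _ ⟨s, hs, h.ge⟩

/-- Every generator is sent into one edge of a translate of `P`; this edge belongs to `K` because
`P` is a path. For a triangle it is the edge of the later block. -/
theorem retract_simplicial (hP : K.IsPath P) :
    Contiguous (rigidification K G P len) K (retract P) (retract P) := by
  intro s hs
  rw [Set.union_self]
  rcases face_cases hs with ⟨a, ha, hsa⟩ | ⟨A, hA, hsA⟩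
  · rw [hsa, Set.image_image]
    simpa [retract] using spans_of_mem_faces ha
  · refine Spans.mono ?_ (Set.image_mono hsA)
    cases hA with
    | block g i =>
      refine (path_spans hP g i).mono ?_
      rintro _ ⟨a, (rfl | rfl | rfl | rfl) | ⟨j, rfl⟩, rfl⟩ <;> simp [retract, BandInner.idx]
    | uEdge g i k hk =>
      obtain ⟨b, hb, h⟩ := uPath_eq_inr (K := K) (len := len) g i k
      obtain ⟨b', hb', h'⟩ := uPath_eq_inr (K := K) (len := len) g i (k + 1)
      refine (path_spans hP g i).mono ?_
      simp [Set.image_pair, h, h', retract, hb, hb']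
    | tEdge g i j k hk =>
      obtain ⟨b, hb, h⟩ := tPath_eq_inr (K := K) (len := len) g i j k
      obtain ⟨b', hb', h'⟩ := tPath_eq_inr (K := K) (len := len) g i j (k + 1)
      refine (path_spans hP g i).mono ?_
      simp [Set.image_pair, h, h', retract, hb, hb']
    | triangle g i i' h =>
      have hx : i.succ = i'.castSucc := by ext; simpa using h
      refine (path_spans hP g i').mono ?_
      simp [Set.image_insert_eq, retract, BandInner.idx, hx]

theorem homotopyEquiv [Finite V] (hP : K.IsPath P) :
    Nonempty ((rigidification K G P len).realization ≃ₕ K.realization) := by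
  have := Fintype.ofFinite V
  have := Fintype.ofFinite (RigidVertex K G len)
  refine homotopyEquiv_of_contiguityClass (retract_simplicial hP) (i := Sum.inl)
    (fun s hs => ?_) rfl ?_
  · rw [Set.union_self]
    exact spans_inl (spans_of_mem_faces hs)
  · rw [inl_comp_retract]
    exact contiguityClass_id_slide

end Rigid

/-! ### Vertex properties invariant under automorphisms. -/

namespace AbstractSimplicialComplex

section Invariants

variable {V : Type*} (L : AbstractSimplicialComplex V)

/-- `a` and `b` are equal or joined by an edge. -/
def Near (a b : V) : Prop := L.Spans {a, b}

/-- `a` has at least two neighbours, and any two vertices near `a` are near each other. -/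
def IsTip (a : V) : Prop :=
  (∃ b c, a ≠ b ∧ a ≠ c ∧ b ≠ c ∧ L.Near a b ∧ L.Near a c) ∧
    ∀ b c, L.Near a b → L.Near a c → L.Near b c

/-- `a` is near at least two tips. -/
def IsCore (a : V) : Prop :=
  ∃ b c, L.IsTip b ∧ L.IsTip c ∧ b ≠ c ∧ L.Near a b ∧ L.Near a c

/-- `a` is near a tip and near a vertex outside the core with a different tip. -/
def IsLinked (a : V) : Prop :=
  ∃ b a' b', ¬ L.IsCore a' ∧ L.IsTip b ∧ L.IsTip b' ∧ b ≠ b' ∧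
    L.Near a b ∧ L.Near a a' ∧ L.Near a' b'

/-- `a` is near no tip. -/
def IsFar (a : V) : Prop := ∀ b, L.IsTip b → ¬ L.Near a b

variable {L}

theorem Near.symm {a b : V} (h : L.Near a b) : L.Near b a := by
  rwa [Near, Set.pair_comm]

theorem Spans.near {A : Set V} (h : L.Spans A) {a b : V} (ha : a ∈ A) (hb : b ∈ A) : L.Near a b :=
  h.mono (Set.pair_subset ha hb)

theorem spans_image_iff (f : L.aut) {A : Set V} :
    L.Spans ((f : Equiv.Perm V) '' A) ↔ L.Spans A := by
  refine ⟨fun hA => ?_, aut_spans f⟩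
  have := aut_spans f⁻¹ hA
  rwa [Set.image_image, Subgroup.coe_inv, show (fun x => (f : Equiv.Perm V)⁻¹ ((f : Equiv.Perm V) x))
    = id from funext fun x => Equiv.symm_apply_apply _ x, Set.image_id] at this

theorem near_apply_iff (f : L.aut) {a b : V} :
    L.Near ((f : Equiv.Perm V) a) ((f : Equiv.Perm V) b) ↔ L.Near a b := by
  rw [Near, ← Set.image_pair, spans_image_iff, Near]

theorem isTip_apply_iff (f : L.aut) {a : V} : L.IsTip ((f : Equiv.Perm V) a) ↔ L.IsTip a := by
  refine Iff.symm (and_congr ?_ ?_)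
  · refine (f : Equiv.Perm V).exists_congr fun b => (f : Equiv.Perm V).exists_congr fun c => ?_
    simp [near_apply_iff]
  · refine (f : Equiv.Perm V).forall_congr fun b => (f : Equiv.Perm V).forall_congr fun c => ?_
    simp [near_apply_iff]

theorem isCore_apply_iff (f : L.aut) {a : V} : L.IsCore ((f : Equiv.Perm V) a) ↔ L.IsCore a := by
  refine Iff.symm
    ((f : Equiv.Perm V).exists_congr fun b => (f : Equiv.Perm V).exists_congr fun c => ?_)
  simp [near_apply_iff, isTip_apply_iff]

theorem isLinked_apply_iff (f : L.aut) {a : V} :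
    L.IsLinked ((f : Equiv.Perm V) a) ↔ L.IsLinked a := by
  refine Iff.symm ((f : Equiv.Perm V).exists_congr fun b => (f : Equiv.Perm V).exists_congr fun c =>
    (f : Equiv.Perm V).exists_congr fun d => ?_)
  simp [near_apply_iff, isTip_apply_iff, isCore_apply_iff]

theorem isFar_apply_iff (f : L.aut) {a : V} : L.IsFar ((f : Equiv.Perm V) a) ↔ L.IsFar a := by
  refine Iff.symm ((f : Equiv.Perm V).forall_congr fun b => ?_)
  simp [near_apply_iff, isTip_apply_iff]

variable (L) in
/-- `p 0, …, p n` is a path attached at its initial vertex. -/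
structure IsTail (p : ℕ → V) (n : ℕ) : Prop where
  near_succ : ∀ k < n, L.Near (p k) (p (k + 1))
  inj : ∀ k ≤ n, ∀ l ≤ n, p k = p l → k = l
  nbr : ∀ k ≤ n, 1 ≤ k → ∀ z, L.Near (p k) z → ∃ l ≤ n, z = p l ∧ l ≤ k + 1 ∧ k ≤ l + 1

/-- Two distinct neighbours of `p k` have indices `k - 1` and `k + 1`, and these vertices are not
near each other. -/
theorem IsTail.not_isTip {p : ℕ → V} {n : ℕ} (hp : L.IsTail p n) {k : ℕ} (hk : k ≤ n)
    (hk1 : 1 ≤ k) : ¬ L.IsTip (p k) := by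
  rintro ⟨⟨b, c, hb, hc, hbc, nb, nc⟩, h⟩
  have hnear := h b c nb nc
  obtain ⟨l, hl, rfl, h1, h2⟩ := hp.nbr k hk hk1 b nb
  obtain ⟨l', hl', rfl, h3, h4⟩ := hp.nbr k hk hk1 c nc
  have e1 : k ≠ l := fun h => hb (h ▸ rfl)
  have e2 : k ≠ l' := fun h => hc (h ▸ rfl)
  have e3 : l ≠ l' := fun h => hbc (h ▸ rfl)
  -- `nbr` says nothing at the initial vertex, so it is applied at the larger of the two indices.
  rcases lt_or_gt_of_ne e3 with h5 | h5
  · obtain ⟨r, hr, e, h6, h7⟩ := hp.nbr l' hl' (by omega) _ hnear.symm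
    have := hp.inj _ hl _ hr e
    omega
  · obtain ⟨r, hr, e, h6, h7⟩ := hp.nbr l hl (by omega) _ hnear
    have := hp.inj _ hl' _ hr e
    omega

/-- An automorphism maps a tail to a tail as soon as this holds for the initial vertices. -/
theorem IsTail.apply_eq (f : L.aut) {p q : ℕ → V} {n n' : ℕ} (hp : L.IsTail p n)
    (hq : L.IsTail q n') (hfar : ∀ k ≤ n, 1 ≤ k → L.IsFar (p k)) (hn' : 1 ≤ n')
    (hq0 : ∀ z, L.Near (q 0) z → L.IsFar z → z = q 1) (h0 : (f : Equiv.Perm V) (p 0) = q 0)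
    (k : ℕ) (hk : k ≤ n) : k ≤ n' ∧ (f : Equiv.Perm V) (p k) = q k := by
  induction k using Nat.strong_induction_on with
  | _ k ih =>
    rcases k with - | k
    · exact ⟨Nat.zero_le _, h0⟩
    have hnear := (near_apply_iff f).mpr (hp.near_succ k hk)
    obtain ⟨hk', e⟩ := ih k (Nat.lt_succ_self k) (by omega)
    rw [e] at hnear
    -- The initial vertex may have many neighbours, but `q 1` is its only far one. Later on, the
    -- image could only step to `q (k + 1)` or to some `q l` with `l ≤ k`; the latter is already the
    -- image of `p l`.
    rcases Nat.eq_zero_or_pos k with rfl | hpos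
    · exact ⟨hn', hq0 _ hnear ((isFar_apply_iff f).mpr (hfar _ hk le_rfl))⟩
    · obtain ⟨l, hl, el, h1, h2⟩ := hq.nbr k hk' hpos _ hnear
      rcases h1.lt_or_eq with h3 | rfl
      · rw [← (ih l h3 (by omega)).2, EmbeddingLike.apply_eq_iff_eq] at el
        have := hp.inj _ hk l (by omega) el
        omega
      · exact ⟨hl, el⟩

/-- Tails with corresponding initial vertices have the same length. -/
theorem IsTail.length_eq (f : L.aut) {p q : ℕ → V} {n n' : ℕ} (hp : L.IsTail p n)
    (hq : L.IsTail q n') (hpfar : ∀ k ≤ n, 1 ≤ k → L.IsFar (p k))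
    (hqfar : ∀ k ≤ n', 1 ≤ k → L.IsFar (q k)) (hn : 1 ≤ n) (hn' : 1 ≤ n')
    (hp0 : ∀ z, L.Near (p 0) z → L.IsFar z → z = p 1)
    (hq0 : ∀ z, L.Near (q 0) z → L.IsFar z → z = q 1)
    (h0 : (f : Equiv.Perm V) (p 0) = q 0) : n = n' := by
  refine le_antisymm (hp.apply_eq f hq hpfar hn' hq0 h0 n le_rfl).1
    (hq.apply_eq f⁻¹ hp hqfar hn hp0 ?_ n' le_rfl).1
  rw [← h0]
  exact Equiv.symm_apply_apply _ _

end Invariants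

end AbstractSimplicialComplex

/-! ### Neighbours of the new vertices. -/

namespace Rigid

variable {V : Type*} {K : AbstractSimplicialComplex V} {G : Subgroup K.aut}
  {m : ℕ} {P : Fin (m + 1) → V} {c : ℕ} {len : Fin m → Fin c → ℕ}

theorem near_inr {g : G} {b : BandInner m c len} {z : RigidVertex K G len}
    (h : (rigidification K G P len).Near (.inr (g, b)) z) :
    ∃ A, Gen K G P len A ∧ Sum.inr (g, b) ∈ A ∧ z ∈ A := by
  obtain ⟨s, hs, h⟩ := h
  obtain ⟨h1, h2⟩ := Set.pair_subset_iff.mp h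
  rcases face_cases hs with ⟨a, -, hsa⟩ | ⟨A, hA, hsA⟩
  · rw [hsa] at h1
    simp at h1
  · exact ⟨A, hA, hsA h1, hsA h2⟩

theorem inr_mem_blk {g g' : G} {i : Fin m} {b : BandInner m c len}
    (h : Sum.inr (g, b) ∈ blk K G P len g' i) :
    g = g' ∧ (b = .y i ∨ b = .w i ∨ ∃ j, b = .v i j) := by
  rcases h with (h | h | h | h) | ⟨j, h⟩ <;> simp_all
  exact .inr (.inr ⟨j, h.2.symm⟩)

theorem uPath_cases (g : G) (i : Fin m) {k : ℕ} (hk : k ≤ i + 1) :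
    (k = 0 ∧ uPath K G len g i k = .inr (g, .w i)) ∨
      ∃ l : Fin ((i : ℕ) + 1), k = l + 1 ∧ uPath K G len g i k = .inr (g, .u i l) := by
  cases k with
  | zero => exact .inl ⟨rfl, rfl⟩
  | succ k => exact .inr ⟨⟨k, hk⟩, rfl, uPath_succ K G len g i ⟨k, hk⟩⟩

theorem tPath_cases (g : G) (i : Fin m) (j : Fin c) {k : ℕ} (hk : k ≤ len i j) :
    (k = 0 ∧ tPath K G len g i j k = .inr (g, .v i j)) ∨
      ∃ l : Fin (len i j), k = l + 1 ∧ tPath K G len g i j k = .inr (g, .t i j l) := by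
  cases k with
  | zero => exact .inl ⟨rfl, rfl⟩
  | succ k => exact .inr ⟨⟨k, hk⟩, rfl, tPath_succ K G len g i j ⟨k, hk⟩⟩

/-- `y i` occurs in no generator except its block, so its neighbourhood records exactly that block.
-/
theorem near_y_iff {g : G} {i : Fin m} {z : RigidVertex K G len} :
    (rigidification K G P len).Near (.inr (g, .y i)) z ↔ z ∈ blk K G P len g i := by
  refine ⟨fun h => ?_, fun h => (Gen.block g i).spans.near (by simp [blk]) h⟩
  obtain ⟨A, hA, h1, h2⟩ := near_inr h
  cases hA with
  | block g' i' => obtain ⟨rfl, h⟩ := inr_mem_blk h1; simp_all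
  | uEdge g' i' k hk =>
    rcases uPath_cases (K := K) (len := len) g' i' hk.le with ⟨_, e⟩ | ⟨l, _, e⟩ <;>
    rcases uPath_cases (K := K) (len := len) g' i' (Nat.succ_le_of_lt hk) with ⟨_, e'⟩ | ⟨l', _, e'⟩ <;>
    simp [e, e'] at h1
  | tEdge g' i' j k hk =>
    rcases tPath_cases (K := K) (len := len) g' i' j hk.le with ⟨_, e⟩ | ⟨l, _, e⟩ <;>
    rcases tPath_cases (K := K) (len := len) g' i' j (Nat.succ_le_of_lt hk) with ⟨_, e'⟩ | ⟨l', _, e'⟩ <;>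
    simp [e, e'] at h1
  | triangle g' i' i'' h => simp at h1

theorem near_v {g : G} {i : Fin m} {j : Fin c} {z : RigidVertex K G len}
    (h : (rigidification K G P len).Near (.inr (g, .v i j)) z) :
    z ∈ blk K G P len g i ∨ z = tPath K G len g i j 1 := by
  obtain ⟨A, hA, h1, h2⟩ := near_inr h
  cases hA with
  | block g' i' => obtain ⟨rfl, h⟩ := inr_mem_blk h1; simp_all
  | uEdge g' i' k hk =>
    rcases uPath_cases (K := K) (len := len) g' i' hk.le with ⟨_, e⟩ | ⟨l, _, e⟩ <;>
    rcases uPath_cases (K := K) (len := len) g' i' (Nat.succ_le_of_lt hk) with ⟨_, e'⟩ | ⟨l', _, e'⟩ <;>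
    simp [e, e'] at h1
  | tEdge g' i' j' k hk =>
    have h0 : k = 0 ∧ g = g' ∧ i = i' ∧ HEq j j' := by
      rcases tPath_cases (K := K) (len := len) g' i' j' hk.le with ⟨_, e⟩ | ⟨l, _, e⟩ <;>
      rcases tPath_cases (K := K) (len := len) g' i' j' (Nat.succ_le_of_lt hk)
        with ⟨_, e'⟩ | ⟨l', _, e'⟩ <;> simp [e, e'] at h1
      · omega
      · simp_all
      · omega
    obtain ⟨rfl, rfl, rfl, h0⟩ := h0
    cases h0
    rcases h2 with rfl | rfl
    · exact .inl (by simp [blk, tPath_zero])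
    · exact .inr rfl
  | triangle g' i' i'' h => simp at h1

/-- The last alternative comes from the triangles. That it stays in copy `g` is what later keeps the
blocks of a copy together. -/
theorem near_w {g : G} {i : Fin m} {z : RigidVertex K G len}
    (h : (rigidification K G P len).Near (.inr (g, .w i)) z) :
    z ∈ blk K G P len g i ∨ z = uPath K G len g i 1 ∨ ∃ i', z = .inr (g, .w i') := by
  obtain ⟨A, hA, h1, h2⟩ := near_inr h
  cases hA with
  | block g' i' => obtain ⟨rfl, h⟩ := inr_mem_blk h1; simp_all
  | uEdge g' i' k hk =>
    have h0 : k = 0 ∧ g = g' ∧ i = i' := by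
      rcases uPath_cases (K := K) (len := len) g' i' hk.le with ⟨_, e⟩ | ⟨l, _, e⟩ <;>
      rcases uPath_cases (K := K) (len := len) g' i' (Nat.succ_le_of_lt hk)
        with ⟨_, e'⟩ | ⟨l', _, e'⟩ <;> simp [e, e'] at h1
      · omega
      · simp_all
      · omega
    obtain ⟨rfl, rfl, rfl⟩ := h0
    rcases h2 with rfl | rfl
    · exact .inl (by simp [blk, uPath_zero])
    · exact .inr (.inl rfl)
  | tEdge g' i' j' k hk =>
    rcases tPath_cases (K := K) (len := len) g' i' j' hk.le with ⟨_, e⟩ | ⟨l, _, e⟩ <;>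
    rcases tPath_cases (K := K) (len := len) g' i' j' (Nat.succ_le_of_lt hk) with ⟨_, e'⟩ | ⟨l', _, e'⟩ <;>
    simp [e, e'] at h1
  | triangle g' i' i'' h =>
    have hx : xv K G P len g' i'.succ = xv K G P len g' i''.castSucc := by
      congr 3; ext; simpa using h
    rcases h2 with rfl | rfl | rfl
    · left
      rcases h1 with h1 | h1 | h1
      · simp at h1
      · obtain ⟨rfl, rfl⟩ : g = g' ∧ i = i' := by simpa using h1
        simp [blk]
      · obtain ⟨rfl, rfl⟩ : g = g' ∧ i = i'' := by simpa using h1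
        simp [blk, hx]
    all_goals
      rcases h1 with h1 | h1 | h1
      · simp at h1
      · obtain ⟨rfl, rfl⟩ : g = g' ∧ i = i' := by simpa using h1
        exact .inr (.inr ⟨_, rfl⟩)
      · obtain ⟨rfl, rfl⟩ : g = g' ∧ i = i'' := by simpa using h1
        exact .inr (.inr ⟨_, rfl⟩)

theorem uPath_inj {g g' : G} {i i' : Fin m} {k k' : ℕ} (hk : k ≤ i + 1) (hk' : k' ≤ i' + 1)
    (h : uPath K G len g i k = uPath K G len g' i' k') : g = g' ∧ i = i' ∧ k = k' := by
  rcases uPath_cases (K := K) (len := len) g i hk with ⟨h1, e⟩ | ⟨l, h1, e⟩ <;>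
  rcases uPath_cases (K := K) (len := len) g' i' hk' with ⟨h2, e'⟩ | ⟨l', h2, e'⟩ <;>
  rw [e, e'] at h <;> simp at h
  · simp_all
  · obtain ⟨rfl, rfl, h⟩ := h
    cases h
    simp_all

theorem tPath_inj {g g' : G} {i i' : Fin m} {j j' : Fin c} {k k' : ℕ} (hk : k ≤ len i j)
    (hk' : k' ≤ len i' j') (h : tPath K G len g i j k = tPath K G len g' i' j' k') :
    g = g' ∧ i = i' ∧ j = j' ∧ k = k' := by
  rcases tPath_cases (K := K) (len := len) g i j hk with ⟨h1, e⟩ | ⟨l, h1, e⟩ <;>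
  rcases tPath_cases (K := K) (len := len) g' i' j' hk' with ⟨h2, e'⟩ | ⟨l', h2, e'⟩ <;>
  rw [e, e'] at h <;> simp at h
  · simp_all
  · obtain ⟨rfl, rfl, rfl, h⟩ := h
    cases h
    simp_all

theorem isTail_uPath (g : G) (i : Fin m) :
    (rigidification K G P len).IsTail (uPath K G len g i) (i + 1) where
  near_succ k hk := (Gen.uEdge g i k hk).spans
  inj k hk l hl h := (uPath_inj hk hl h).2.2
  nbr k hk hk1 z hz := by
    obtain ⟨l, rfl, e⟩ := (uPath_cases (K := K) (len := len) g i hk).resolve_left (by omega)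
    rw [e] at hz
    obtain ⟨A, hA, h1, h2⟩ := near_inr hz
    cases hA with
    | block g' i' => obtain ⟨rfl, h⟩ := inr_mem_blk h1; simp_all
    | uEdge g' i' k hk' =>
      rw [← e] at h1
      rcases h1 with h1 | h1
      · obtain ⟨rfl, rfl, rfl⟩ := uPath_inj hk hk'.le h1
        rcases h2 with rfl | rfl
        · exact ⟨_, hk, rfl, by omega, by omega⟩
        · exact ⟨_, hk', rfl, by omega, by omega⟩
      · obtain ⟨rfl, rfl, h⟩ := uPath_inj hk hk' h1
        rcases h2 with rfl | rfl
        · exact ⟨_, hk'.le, rfl, by omega, by omega⟩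
        · exact ⟨_, hk', rfl, by omega, by omega⟩
    | tEdge g' i' j' k hk =>
      rcases tPath_cases (K := K) (len := len) g' i' j' hk.le with ⟨_, e⟩ | ⟨l, _, e⟩ <;>
      rcases tPath_cases (K := K) (len := len) g' i' j' (Nat.succ_le_of_lt hk)
        with ⟨_, e'⟩ | ⟨l', _, e'⟩ <;> simp [e, e'] at h1
    | triangle g' i' i'' h => simp at h1

theorem isTail_tPath (g : G) (i : Fin m) (j : Fin c) :
    (rigidification K G P len).IsTail (tPath K G len g i j) (len i j) where
  near_succ k hk := (Gen.tEdge g i j k hk).spans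
  inj k hk l hl h := (tPath_inj hk hl h).2.2.2
  nbr k hk hk1 z hz := by
    obtain ⟨l, rfl, e⟩ := (tPath_cases (K := K) (len := len) g i j hk).resolve_left (by omega)
    rw [e] at hz
    obtain ⟨A, hA, h1, h2⟩ := near_inr hz
    cases hA with
    | block g' i' => obtain ⟨rfl, h⟩ := inr_mem_blk h1; simp_all
    | tEdge g' i' j' k hk' =>
      rw [← e] at h1
      rcases h1 with h1 | h1
      · obtain ⟨rfl, rfl, rfl, rfl⟩ := tPath_inj hk hk'.le h1
        rcases h2 with rfl | rfl
        · exact ⟨_, hk, rfl, by omega, by omega⟩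
        · exact ⟨_, hk', rfl, by omega, by omega⟩
      · obtain ⟨rfl, rfl, rfl, h⟩ := tPath_inj hk hk' h1
        rcases h2 with rfl | rfl
        · exact ⟨_, hk'.le, rfl, by omega, by omega⟩
        · exact ⟨_, hk', rfl, by omega, by omega⟩
    | uEdge g' i' k hk =>
      rcases uPath_cases (K := K) (len := len) g' i' hk.le with ⟨_, e⟩ | ⟨l, _, e⟩ <;>
      rcases uPath_cases (K := K) (len := len) g' i' (Nat.succ_le_of_lt hk)
        with ⟨_, e'⟩ | ⟨l', _, e'⟩ <;> simp [e, e'] at h1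
    | triangle g' i' i'' h => simp at h1

end Rigid

/-! ### Recognition of the kinds of vertices. -/

namespace Rigid

variable {V : Type*} {K : AbstractSimplicialComplex V} {G : Subgroup K.aut}
  {m : ℕ} {P : Fin (m + 1) → V} {c : ℕ} {len : Fin m → Fin c → ℕ}

theorem idx_of_inr_mem_blk {g g' : G} {i : Fin m} {b : BandInner m c len}
    (h : Sum.inr (g, b) ∈ blk K G P len g' i) : g = g' ∧ b.idx = i := by
  obtain ⟨rfl, rfl | rfl | ⟨j, rfl⟩⟩ := inr_mem_blk h <;> exact ⟨rfl, rfl⟩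

/-- Each translate of `P` visits every vertex of `K`, so every copy of the band has a block there.
-/
theorem exists_inl_mem_blk (hm : 2 ≤ m) (hP : Function.Surjective P) (g : G) (x : V) :
    ∃ i, Sum.inl x ∈ blk K G P len g i := by
  obtain ⟨k, hk⟩ := hP (((g : K.aut) : Equiv.Perm V).symm x)
  have hx : Sum.inl x = xv K G P len g k := by simp [hk]
  rw [hx]
  rcases Fin.eq_castSucc_or_eq_last k with ⟨i, rfl⟩ | rfl
  · exact ⟨i, by simp [blk]⟩
  · obtain ⟨n, rfl⟩ : ∃ n, m = n + 1 := ⟨m - 1, by omega⟩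
    refine ⟨Fin.last n, ?_⟩
    rw [← Fin.succ_last]
    simp [blk]

theorem isTip_y (g : G) (i : Fin m) : (rigidification K G P len).IsTip (.inr (g, .y i)) := by
  refine ⟨⟨xv K G P len g i.succ, .inr (g, .w i), by simp, by simp, by simp,
    near_y_iff.mpr (by simp [blk]), near_y_iff.mpr (by simp [blk])⟩, fun b c hb hc => ?_⟩
  exact (Gen.block g i).spans.near (near_y_iff.mp hb) (near_y_iff.mp hc)

theorem uPath_one (g : G) (i : Fin m) :
    uPath K G len g i 1 = .inr (g, .u i 0) :=
  uPath_succ K G len g i 0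

/-- A vertex of `K` is near `y`s of two copies, and a `w` or `v` is near its `y` and the start of
its attached path; neither pair is near each other. The remaining vertices lie on tails. -/
theorem isTip_iff (hm : 2 ≤ m) (hP : Function.Surjective P) (hG : G ≠ ⊥)
    (hpos : ∀ i j, 1 ≤ len i j) {a : RigidVertex K G len} :
    (rigidification K G P len).IsTip a ↔ ∃ g i, a = .inr (g, .y i) := by
  refine ⟨fun h => ?_, ?_⟩
  · rcases a with x | ⟨g, i | i | ⟨i, j⟩ | ⟨i, k⟩ | ⟨i, j, k⟩⟩
    · obtain ⟨g, g', hg⟩ := (Subgroup.nontrivial_iff_ne_bot G).mpr hG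
      obtain ⟨i, hi⟩ := exists_inl_mem_blk (len := len) hm hP g x
      obtain ⟨i', hi'⟩ := exists_inl_mem_blk (len := len) hm hP g' x
      have := h.2 _ _ (near_y_iff.mpr hi).symm (near_y_iff.mpr hi').symm
      exact (hg (idx_of_inr_mem_blk (near_y_iff.mp this)).1.symm).elim
    · exact ⟨g, i, rfl⟩
    · have h1 : (rigidification K G P len).Near (.inr (g, .w i)) (.inr (g, .y i)) :=
        (near_y_iff.mpr (by simp [blk])).symm
      have h2 := h.2 _ _ h1 ((isTail_uPath g i).near_succ 0 (Nat.succ_pos _))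
      rw [near_y_iff, zero_add, uPath_one] at h2
      simpa using (inr_mem_blk h2).2
    · have h1 : (rigidification K G P len).Near (.inr (g, .v i j)) (.inr (g, .y i)) :=
        (near_y_iff.mpr (by simp [blk])).symm
      have h2 := h.2 _ _ h1 ((isTail_tPath g i j).near_succ 0 (hpos i j))
      rw [near_y_iff, zero_add, ← Nat.zero_add 1, tPath_succ K G len g i j ⟨0, hpos i j⟩] at h2
      simpa using (inr_mem_blk h2).2
    · rw [← uPath_succ] at h
      exact ((isTail_uPath g i).not_isTip k.2 (Nat.succ_pos _) h).elim
    · rw [← tPath_succ] at h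
      exact ((isTail_tPath g i j).not_isTip k.2 (Nat.succ_pos _) h).elim
  · rintro ⟨g, i, rfl⟩
    exact isTip_y g i

theorem isCore_iff (hm : 2 ≤ m) (hP : Function.Surjective P) (hG : G ≠ ⊥)
    (hpos : ∀ i j, 1 ≤ len i j) {a : RigidVertex K G len} :
    (rigidification K G P len).IsCore a ↔ ∃ x, a = .inl x := by
  refine ⟨?_, ?_⟩
  · rintro ⟨b, b', hb, hb', hne, h, h'⟩
    obtain ⟨g, i, rfl⟩ := (isTip_iff hm hP hG hpos).mp hb
    obtain ⟨g', i', rfl⟩ := (isTip_iff hm hP hG hpos).mp hb'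
    rcases a with x | ⟨g₀, a⟩
    · exact ⟨x, rfl⟩
    · obtain ⟨rfl, rfl⟩ := idx_of_inr_mem_blk (near_y_iff.mp h.symm)
      obtain ⟨rfl, rfl⟩ := idx_of_inr_mem_blk (near_y_iff.mp h'.symm)
      exact (hne rfl).elim
  · rintro ⟨x, rfl⟩
    obtain ⟨g, g', hg⟩ := (Subgroup.nontrivial_iff_ne_bot G).mpr hG
    obtain ⟨i, hi⟩ := exists_inl_mem_blk (len := len) hm hP g x
    obtain ⟨i', hi'⟩ := exists_inl_mem_blk (len := len) hm hP g' x
    exact ⟨_, _, isTip_y g i, isTip_y g' i', by simp [hg], (near_y_iff.mpr hi).symm,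
      (near_y_iff.mpr hi').symm⟩

theorem isFar_of_not_mem_blk (hm : 2 ≤ m) (hP : Function.Surjective P) (hG : G ≠ ⊥)
    (hpos : ∀ i j, 1 ≤ len i j) {a : RigidVertex K G len}
    (ha : ∀ g i, a ∉ blk K G P len g i) : (rigidification K G P len).IsFar a := by
  intro b hb h
  obtain ⟨g, i, rfl⟩ := (isTip_iff hm hP hG hpos).mp hb
  exact ha g i (near_y_iff.mp h.symm)

theorem not_mem_blk_of_isFar {a : RigidVertex K G len} (h : (rigidification K G P len).IsFar a)
    (g : G) (i : Fin m) : a ∉ blk K G P len g i :=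
  fun ha => h _ (isTip_y g i) (near_y_iff.mpr ha).symm

theorem isFar_uPath (hm : 2 ≤ m) (hP : Function.Surjective P) (hG : G ≠ ⊥)
    (hpos : ∀ i j, 1 ≤ len i j) (g : G) (i : Fin m) (k : ℕ) (hk : k ≤ i + 1) (hk1 : 1 ≤ k) :
    (rigidification K G P len).IsFar (uPath K G len g i k) := by
  obtain ⟨l, rfl, e⟩ := (uPath_cases (K := K) (len := len) g i hk).resolve_left (by omega)
  rw [e]
  exact isFar_of_not_mem_blk hm hP hG hpos fun g' i' h => by simpa using (inr_mem_blk h).2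

theorem isFar_tPath (hm : 2 ≤ m) (hP : Function.Surjective P) (hG : G ≠ ⊥)
    (hpos : ∀ i j, 1 ≤ len i j) (g : G) (i : Fin m) (j : Fin c) (k : ℕ) (hk : k ≤ len i j)
    (hk1 : 1 ≤ k) : (rigidification K G P len).IsFar (tPath K G len g i j k) := by
  obtain ⟨l, rfl, e⟩ := (tPath_cases (K := K) (len := len) g i j hk).resolve_left (by omega)
  rw [e]
  exact isFar_of_not_mem_blk hm hP hG hpos fun g' i' h => by simpa using (inr_mem_blk h).2

theorem eq_uPath_one (g : G) (i : Fin m) (z : RigidVertex K G len)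
    (h : (rigidification K G P len).Near (uPath K G len g i 0) z)
    (hz : (rigidification K G P len).IsFar z) : z = uPath K G len g i 1 := by
  rcases near_w h with h | h | ⟨i', rfl⟩
  · exact (not_mem_blk_of_isFar hz _ _ h).elim
  · exact h
  · exact (not_mem_blk_of_isFar hz g i' (by simp [blk])).elim

theorem eq_tPath_one (g : G) (i : Fin m) (j : Fin c) (z : RigidVertex K G len)
    (h : (rigidification K G P len).Near (tPath K G len g i j 0) z)
    (hz : (rigidification K G P len).IsFar z) : z = tPath K G len g i j 1 :=
  (near_v h).resolve_left fun h => not_mem_blk_of_isFar hz _ _ h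

theorem near_w_w (g : G) {i i' : Fin m} (h : (i : ℕ) + 1 = i' ∨ (i' : ℕ) + 1 = i) :
    (rigidification K G P len).Near (.inr (g, .w i)) (.inr (g, .w i')) := by
  rcases h with h | h
  · exact (Gen.triangle g i i' h).spans.near (by simp) (by simp)
  · exact (Gen.triangle g i' i h).spans.near (by simp) (by simp)

theorem isLinked_w (hm : 2 ≤ m) (hP : Function.Surjective P) (hG : G ≠ ⊥)
    (hpos : ∀ i j, 1 ≤ len i j) (g : G) (i : Fin m) :
    (rigidification K G P len).IsLinked (.inr (g, .w i)) := by
  -- With at least two blocks there is an adjacent one: the next, or the previous one for the last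
  -- block.
  obtain ⟨i', hi'⟩ : ∃ i' : Fin m, (i : ℕ) + 1 = i' ∨ (i' : ℕ) + 1 = i := by
    by_cases h : (i : ℕ) + 1 < m
    · exact ⟨⟨i + 1, h⟩, .inl rfl⟩
    · exact ⟨⟨i - 1, by omega⟩, .inr (by dsimp only; omega)⟩
  refine ⟨.inr (g, .y i), .inr (g, .w i'), .inr (g, .y i'), ?_, isTip_y g i, isTip_y g i', ?_,
    (near_y_iff.mpr (by simp [blk])).symm, near_w_w g hi', (near_y_iff.mpr (by simp [blk])).symm⟩
  · simp [isCore_iff hm hP hG hpos]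
  · intro h
    obtain rfl : i = i' := by simpa using h
    omega

/-- Outside `K`, the neighbours of `v i j` lie in its own block, whose only tip is `y i`, or on the
attached path, which is near no tip. -/
theorem not_isLinked_v (hm : 2 ≤ m) (hP : Function.Surjective P) (hG : G ≠ ⊥)
    (hpos : ∀ i j, 1 ≤ len i j) (g : G) (i : Fin m) (j : Fin c) :
    ¬ (rigidification K G P len).IsLinked (.inr (g, .v i j)) := by
  rintro ⟨b, a', b', ha', hb, hb', hne, h1, h2, h3⟩
  obtain ⟨g₁, i₁, rfl⟩ := (isTip_iff hm hP hG hpos).mp hb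
  obtain ⟨g₂, i₂, rfl⟩ := (isTip_iff hm hP hG hpos).mp hb'
  obtain ⟨rfl, rfl⟩ := idx_of_inr_mem_blk (near_y_iff.mp h1.symm)
  have h3 := near_y_iff.mp h3.symm
  rcases a' with x | ⟨g₃, a⟩
  · exact ha' ((isCore_iff hm hP hG hpos).mpr ⟨x, rfl⟩)
  rcases near_v h2 with h | h
  · obtain ⟨rfl, e⟩ := idx_of_inr_mem_blk h
    obtain ⟨rfl, rfl⟩ := idx_of_inr_mem_blk h3
    exact hne (by rw [e]; rfl)
  · exact not_mem_blk_of_isFar (isFar_tPath hm hP hG hpos g i j 1 (hpos i j) le_rfl) _ _ (h ▸ h3)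

theorem not_isLinked_y (hm : 2 ≤ m) (hP : Function.Surjective P) (hG : G ≠ ⊥)
    (hpos : ∀ i j, 1 ≤ len i j) (g : G) (i : Fin m) :
    ¬ (rigidification K G P len).IsLinked (.inr (g, .y i)) := by
  rintro ⟨b, a', b', ha', hb, hb', hne, h1, h2, h3⟩
  obtain ⟨g₁, i₁, rfl⟩ := (isTip_iff hm hP hG hpos).mp hb
  obtain ⟨g₂, i₂, rfl⟩ := (isTip_iff hm hP hG hpos).mp hb'
  obtain ⟨rfl, rfl⟩ := idx_of_inr_mem_blk (near_y_iff.mp h1.symm)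
  have h3 := near_y_iff.mp h3.symm
  rcases a' with x | ⟨g₃, a⟩
  · exact ha' ((isCore_iff hm hP hG hpos).mpr ⟨x, rfl⟩)
  obtain ⟨rfl, e⟩ := idx_of_inr_mem_blk (near_y_iff.mp h2)
  obtain ⟨rfl, rfl⟩ := idx_of_inr_mem_blk h3
  exact hne (by rw [e]; rfl)

/-! ### Automorphisms on the inner vertices of the bands. -/

section Automorphism

variable (hm : 2 ≤ m) (hP : Function.Surjective P) (hG : G ≠ ⊥) (hpos : ∀ i j, 1 ≤ len i j)
  (f : (rigidification K G P len).aut)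

include hm hP hG hpos

theorem aut_inl (x : V) : ∃ x', (f : Equiv.Perm (RigidVertex K G len)) (.inl x) = .inl x' := by
  rw [← isCore_iff hm hP hG hpos, isCore_apply_iff, isCore_iff hm hP hG hpos]
  exact ⟨x, rfl⟩

theorem aut_inr (a : G × BandInner m c len) :
    ∃ a', (f : Equiv.Perm (RigidVertex K G len)) (.inr a) = .inr a' := by
  have h : ¬ (rigidification K G P len).IsCore
      ((f : Equiv.Perm (RigidVertex K G len)) (.inr a)) := by
    rw [isCore_apply_iff, isCore_iff hm hP hG hpos]
    simp
  rcases e : (f : Equiv.Perm (RigidVertex K G len)) (.inr a) with x | a'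
  · exact (h ((isCore_iff hm hP hG hpos).mpr ⟨x, e⟩)).elim
  · exact ⟨a', rfl⟩

/-- Being linked forces the image of `w i` to be a `w` of the image block; the attached path of
length `i + 1` then reveals the block number. -/
theorem aut_block (g : G) (i : Fin m) :
    ∃ g', (f : Equiv.Perm (RigidVertex K G len)) (.inr (g, .y i)) = .inr (g', .y i) ∧
      (f : Equiv.Perm (RigidVertex K G len)) (.inr (g, .w i)) = .inr (g', .w i) := by
  obtain ⟨g', i', hy⟩ := (isTip_iff hm hP hG hpos).mp
    ((isTip_apply_iff f).mpr (isTip_y (P := P) (len := len) g i))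
  have hmem : Sum.inr (g, .w i) ∈ blk K G P len g i := by simp [blk]
  have hnear := (near_apply_iff f).mpr (near_y_iff.mpr hmem)
  have hlink := (isLinked_apply_iff f).mpr (isLinked_w hm hP hG hpos g i)
  obtain ⟨⟨g₁, b⟩, hw⟩ := aut_inr hm hP hG hpos f (g, .w i)
  rw [hw] at hnear hlink
  rw [hy, near_y_iff] at hnear
  obtain ⟨rfl, rfl | rfl | ⟨j, rfl⟩⟩ := inr_mem_blk hnear
  · exact (not_isLinked_y hm hP hG hpos _ _ hlink).elim
  · have := (isTail_uPath g i).length_eq f (isTail_uPath g₁ i')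
      (isFar_uPath hm hP hG hpos g i) (isFar_uPath hm hP hG hpos g₁ i') (by omega) (by omega)
      (eq_uPath_one g i) (eq_uPath_one g₁ i') hw
    obtain rfl : i = i' := by ext; omega
    exact ⟨g₁, hy, hw⟩
  · exact (not_isLinked_v hm hP hG hpos _ _ _ hlink).elim

theorem aut_v (hinj : ∀ i, Function.Injective (len i)) (g g' : G) (i : Fin m) (j : Fin c)
    (hy : (f : Equiv.Perm (RigidVertex K G len)) (.inr (g, .y i)) = .inr (g', .y i))
    (hw : (f : Equiv.Perm (RigidVertex K G len)) (.inr (g, .w i)) = .inr (g', .w i)) :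
    (f : Equiv.Perm (RigidVertex K G len)) (.inr (g, .v i j)) = .inr (g', .v i j) := by
  have hmem : Sum.inr (g, .v i j) ∈ blk K G P len g i := by simp [blk]
  have hnear := (near_apply_iff f).mpr (near_y_iff.mpr hmem)
  obtain ⟨⟨g₁, b⟩, hv⟩ := aut_inr hm hP hG hpos f (g, .v i j)
  rw [hv, hy, near_y_iff] at hnear
  -- The values `y` and `w` are already taken; among the `v`, the distinct path lengths decide.
  obtain ⟨rfl, rfl | rfl | ⟨j', rfl⟩⟩ := inr_mem_blk hnear
  · rw [← hy, EmbeddingLike.apply_eq_iff_eq] at hv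
    simp at hv
  · rw [← hw, EmbeddingLike.apply_eq_iff_eq] at hv
    simp at hv
  · have := (isTail_tPath g i j).length_eq f (isTail_tPath g₁ i j')
      (isFar_tPath hm hP hG hpos g i j) (isFar_tPath hm hP hG hpos g₁ i j') (hpos _ _) (hpos _ _)
      (eq_tPath_one g i j) (eq_tPath_one g₁ i j') hv
    rw [hv, hinj i this]

theorem aut_inner (hinj : ∀ i, Function.Injective (len i)) (g : G) (i : Fin m) :
    ∃ g', ∀ b : BandInner m c len, b.idx = i →
      (f : Equiv.Perm (RigidVertex K G len)) (.inr (g, b)) = .inr (g', b) := by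
  obtain ⟨g', hy, hw⟩ := aut_block hm hP hG hpos f g i
  have hv := fun j => aut_v hm hP hG hpos f hinj g g' i j hy hw
  refine ⟨g', ?_⟩
  rintro (i | i | ⟨i, j⟩ | ⟨i, k⟩ | ⟨i, j, k⟩) rfl
  · exact hy
  · exact hw
  · exact hv j
  · rw [← uPath_succ, ← uPath_succ]
    exact ((isTail_uPath g i).apply_eq f (isTail_uPath g' i) (isFar_uPath hm hP hG hpos g i)
      (by omega) (eq_uPath_one g' i) hw _ k.2).2
  · rw [← tPath_succ, ← tPath_succ]
    exact ((isTail_tPath g i j).apply_eq f (isTail_tPath g' i j)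
      (isFar_tPath hm hP hG hpos g i j) (hpos i j) (eq_tPath_one g' i j) (hv j) _ k.2).2

/-- Consecutive `w` are near each other, while the `w` of different copies are not, so the copy
index is constant along the band. -/
theorem aut_copy (hinj : ∀ i, Function.Injective (len i)) (g : G) :
    ∃ g', ∀ b : BandInner m c len,
      (f : Equiv.Perm (RigidVertex K G len)) (.inr (g, b)) = .inr (g', b) := by
  choose φ hφ using aut_inner hm hP hG hpos f hinj g
  have hstep : ∀ i i' : Fin m, (i : ℕ) + 1 = i' → φ i' = φ i := by
    intro i i' h
    have hnear := (near_apply_iff f).mpr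
      (near_w_w (K := K) (P := P) (len := len) g (.inl h))
    rw [hφ i _ rfl, hφ i' _ rfl] at hnear
    rcases near_w hnear with h | h | ⟨_, h⟩
    · exact (idx_of_inr_mem_blk h).1
    · rw [uPath_one] at h
      simp at h
    · exact (Prod.ext_iff.mp (Sum.inr_injective h)).1
  have hconst : ∀ (k : ℕ) (hk : k < m), φ ⟨k, hk⟩ = φ ⟨0, by omega⟩ := by
    intro k
    induction k with
    | zero => exact fun _ => rfl
    | succ k ih => exact fun hk => (hstep ⟨k, by omega⟩ ⟨k + 1, hk⟩ rfl).trans (ih _)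
  exact ⟨φ ⟨0, by omega⟩, fun b => (hφ b.idx b rfl).trans (by rw [← hconst b.idx b.idx.2])⟩

end Automorphism

theorem xv_inj {g g' : G} {k l : Fin (m + 1)} (h : xv K G P len g k = xv K G P len g l) :
    xv K G P len g' k = xv K G P len g' l := by
  simpa using h

theorem inl_mem_blk {g : G} {i : Fin m} {x : V} (h : Sum.inl x ∈ blk K G P len g i) :
    Sum.inl x = xv K G P len g i.castSucc ∨ Sum.inl x = xv K G P len g i.succ := by
  rcases h with (h | h | h | h) | ⟨j, h⟩ <;> simp_all

/-- Only a triangle contains the `w` of two different blocks. -/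
theorem Gen.eq_of_inl_mem {A : Set (RigidVertex K G len)} (hA : Gen K G P len A) {g : G}
    {i i' : Fin m} (hi : (i : ℕ) + 1 = i') {x : V} (h1 : Sum.inr (g, .w i) ∈ A)
    (h2 : Sum.inr (g, .w i') ∈ A) (hx : Sum.inl x ∈ A) : Sum.inl x = xv K G P len g i.succ := by
  cases hA with
  | block g' j =>
    have e1 : i = j := (idx_of_inr_mem_blk h1).2
    have e2 : i' = j := (idx_of_inr_mem_blk h2).2
    omega
  | uEdge g' j k hk =>
    obtain ⟨b, -, e⟩ := uPath_eq_inr (K := K) (len := len) g' j k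
    obtain ⟨b', -, e'⟩ := uPath_eq_inr (K := K) (len := len) g' j (k + 1)
    simp [e, e'] at hx
  | tEdge g' j l k hk =>
    obtain ⟨b, -, e⟩ := tPath_eq_inr (K := K) (len := len) g' j l k
    obtain ⟨b', -, e'⟩ := tPath_eq_inr (K := K) (len := len) g' j l (k + 1)
    simp [e, e'] at hx
  | triangle g' j j' h =>
    have hx : Sum.inl x = xv K G P len g' j.succ := by simpa using hx
    have h1 : g = g' ∧ i = j ∨ g = g' ∧ i = j' := by simpa using h1
    have h2 : g = g' ∧ i' = j ∨ g = g' ∧ i' = j' := by simpa using h2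
    rcases h1 with ⟨rfl, rfl⟩ | ⟨rfl, rfl⟩
    · exact hx
    · rcases h2 with ⟨-, rfl⟩ | ⟨-, rfl⟩ <;> omega

/-! ### Automorphisms on the path vertices. -/

section Automorphism

variable (hm : 2 ≤ m) (hP : Function.Surjective P) (hG : G ≠ ⊥) (hpos : ∀ i j, 1 ≤ len i j)
  (f : (rigidification K G P len).aut)

include hm hP hG hpos

/-- The two blocks alone would not determine the image: where `P` goes back along an edge, they have
the same vertices in `K`. The triangle singles out the right one. -/
theorem aut_path_interior {g g' : G} (hf : ∀ b : BandInner m c len,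
      (f : Equiv.Perm (RigidVertex K G len)) (.inr (g, b)) = .inr (g', b)) {i i' : Fin m}
    (hi : (i : ℕ) + 1 = i') :
    (f : Equiv.Perm (RigidVertex K G len)) (xv K G P len g i.succ) = xv K G P len g' i.succ := by
  obtain ⟨x, hx⟩ := aut_inl hm hP hG hpos f (((g : K.aut) : Equiv.Perm V) (P i.succ))
  have hspan := (spans_image_iff f).mpr (Gen.triangle (P := P) (len := len) g i i' hi).spans
  simp only [Set.image_insert_eq, Set.image_singleton, hf, hx] at hspan
  obtain ⟨s, hs, hsub⟩ := hspan
  rw [hx]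
  rcases face_cases hs with ⟨a, -, hsa⟩ | ⟨A, hA, hsA⟩
  · have h : Sum.inr (g', .w i) ∈ (s : Set (RigidVertex K G len)) := hsub (by simp)
    rw [hsa] at h
    simp at h
  · have hsub := hsub.trans hsA
    exact hA.eq_of_inl_mem hi (hsub (by simp)) (hsub (by simp)) (hsub (by simp))

theorem aut_path_block {g g' : G} (hf : ∀ b : BandInner m c len,
      (f : Equiv.Perm (RigidVertex K G len)) (.inr (g, b)) = .inr (g', b)) {i : Fin m}
    {k : Fin (m + 1)} (hk : k = i.castSucc ∨ k = i.succ) :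
    (f : Equiv.Perm (RigidVertex K G len)) (xv K G P len g k) = xv K G P len g' i.castSucc ∨
    (f : Equiv.Perm (RigidVertex K G len)) (xv K G P len g k) = xv K G P len g' i.succ := by
  have hmem : xv K G P len g k ∈ blk K G P len g i := by rcases hk with rfl | rfl <;> simp [blk]
  have hnear := (near_apply_iff f).mpr (near_y_iff.mpr hmem)
  obtain ⟨x, hx⟩ := aut_inl hm hP hG hpos f (((g : K.aut) : Equiv.Perm V) (P k))
  rw [hf, near_y_iff] at hnear
  rw [hx] at hnear ⊢
  exact inl_mem_blk hnear

theorem aut_path {g g' : G} (hf : ∀ b : BandInner m c len,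
      (f : Equiv.Perm (RigidVertex K G len)) (.inr (g, b)) = .inr (g', b)) (k : Fin (m + 1)) :
    (f : Equiv.Perm (RigidVertex K G len)) (xv K G P len g k) = xv K G P len g' k := by
  by_cases h0 : k = 0
  · have hk : k = (⟨0, by omega⟩ : Fin m).castSucc := by rw [h0]; rfl
    rcases aut_path_block hm hP hG hpos f hf (.inl hk) with h | h
    · rw [h, hk]
    -- The value in question is already taken by the interior vertex of the same block. So by
    -- injectivity both path vertices coincide, and hence so do their translates; the other end is
    -- treated likewise.
    · have h1 := aut_path_interior hm hP hG hpos f hf (i := ⟨0, by omega⟩) (i' := ⟨1, by omega⟩) rfl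
      rw [h]
      rw [← h1, EmbeddingLike.apply_eq_iff_eq] at h
      exact (xv_inj h).symm
  obtain ⟨i, rfl⟩ := Fin.exists_succ_eq.mpr h0
  by_cases hi : (i : ℕ) + 1 < m
  · exact aut_path_interior hm hP hG hpos f hf (i' := ⟨i + 1, hi⟩) rfl
  · rcases aut_path_block hm hP hG hpos f hf (i := i) (.inr rfl) with h | h
    · have h1 := aut_path_interior hm hP hG hpos f hf (i := ⟨i - 1, by omega⟩) (i' := i)
        (by dsimp only; omega)
      have e : (⟨(i : ℕ) - 1, by omega⟩ : Fin m).succ = i.castSucc := by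
        ext
        simp only [Fin.val_succ, Fin.val_castSucc]
        omega
      rw [e] at h1
      rw [h]
      rw [← h1, EmbeddingLike.apply_eq_iff_eq] at h
      exact (xv_inj h).symm
    · exact h

end Automorphism

/-! ### The action of `G` as the full automorphism group. -/

variable (K G len) in
/-- The action of `G` on the vertices of the rigidification. -/
def actPerm : G →* Equiv.Perm (RigidVertex K G len) where
  toFun h := Equiv.sumCongr ((h : K.aut) : Equiv.Perm V)
    ((Equiv.mulLeft h).prodCongr (Equiv.refl (BandInner m c len)))
  map_one' := by ext (x | ⟨g, b⟩) <;> simp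
  map_mul' h h' := by ext (x | ⟨g, b⟩) <;> simp [mul_assoc]

theorem actPerm_inl (h : G) (x : V) :
    actPerm K G len h (.inl x) = .inl (((h : K.aut) : Equiv.Perm V) x) := rfl

theorem actPerm_inr (h g : G) (b : BandInner m c len) :
    actPerm K G len h (.inr (g, b)) = .inr (h * g, b) := rfl

theorem actPerm_glue (h g : G) (a : Band.Vertex m c len) :
    actPerm K G len h (rigidGlue K G P len g a) = rigidGlue K G P len (h * g) a := by
  rcases a with x | b <;> rfl

theorem map_actPerm_mem (h : G) {s : Finset (RigidVertex K G len)}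
    (hs : s ∈ (rigidification K G P len).faces) :
    s.map (actPerm K G len h).toEmbedding ∈ (rigidification K G P len).faces := by
  rcases hs with ⟨a, ha, hsa⟩ | ⟨g, a, ha, hsa⟩
  · refine .inl ⟨a.map ((h : K.aut) : Equiv.Perm V).toEmbedding, ((h : K.aut).2 a).mpr ha, ?_⟩
    rw [Finset.coe_map, hsa, Finset.coe_map, Set.image_image, Set.image_image]
    rfl
  · refine .inr ⟨h * g, a, ha, ?_⟩
    rw [Finset.coe_map, hsa, Set.image_image]
    exact Set.image_congr fun x _ => actPerm_glue h g x

theorem actPerm_mem_aut (h : G) : actPerm K G len h ∈ (rigidification K G P len).aut := by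
  intro s
  refine ⟨fun hs => ?_, map_actPerm_mem h⟩
  have := map_actPerm_mem h⁻¹ hs
  rw [Finset.map_map] at this
  convert this
  rw [show (actPerm K G len h).toEmbedding.trans (actPerm K G len h⁻¹).toEmbedding
    = Function.Embedding.refl _ from ?_, Finset.map_refl]
  ext1 x
  have h1 : actPerm K G len h⁻¹ * actPerm K G len h = 1 := by
    rw [← map_mul, inv_mul_cancel, map_one]
  exact Equiv.congr_fun h1 x

variable (P len) in
/-- The homomorphism from `G` to the automorphism group of the rigidification. -/
def actHom : G →* (rigidification K G P len).aut :=
  (actPerm K G len).codRestrict _ actPerm_mem_aut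

theorem actHom_injective : Function.Injective (actHom (K := K) (G := G) P len) := by
  intro h h' e
  have e : actPerm K G len h = actPerm K G len h' := congrArg Subtype.val e
  ext x
  simpa [actPerm_inl] using Equiv.congr_fun e (.inl x)

theorem actHom_surjective (hm : 2 ≤ m) (hP : Function.Surjective P) (hG : G ≠ ⊥)
    (hpos : ∀ i j, 1 ≤ len i j) (hinj : ∀ i, Function.Injective (len i)) :
    Function.Surjective (actHom (K := K) (G := G) P len) := by
  intro f
  choose φ hφ using aut_copy hm hP hG hpos f hinj
  have hpath := fun g => aut_path hm hP hG hpos f (hφ g)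
  have hinl : ∀ x, (f : Equiv.Perm (RigidVertex K G len)) (.inl x) =
      .inl (((φ 1 : K.aut) : Equiv.Perm V) x) := by
    intro x
    obtain ⟨k, rfl⟩ := hP x
    exact hpath 1 k
  refine ⟨φ 1, Subtype.ext (Equiv.ext ?_)⟩
  change ∀ a, actPerm K G len (φ 1) a = (f : Equiv.Perm (RigidVertex K G len)) a
  rintro (x | ⟨g, b⟩)
  · rw [hinl, actPerm_inl]
  · rw [hφ, actPerm_inr]
    -- Comparing `f (g • P k)` computed on `K` and computed in copy `g` yields `φ 1 * g = φ g`.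
    congr 2
    ext x
    obtain ⟨k, rfl⟩ := hP x
    simpa using (hinl _).symm.trans (hpath g k)

end Rigid

theorem mainTheorem4 {V : Type*} [Finite V] (K : AbstractSimplicialComplex V)
    (hK : K.IsConnected) (n : ℕ) (hn : K.HasDimension n)
    (G : Subgroup K.aut) (hG : G ≠ ⊥)
    (m : ℕ) (P : Fin (m + 1) → V) (hP : K.IsPath P) (hPsurj : Function.Surjective P)
    (hm : 2 ≤ m)
    (d : ℕ) (hd3 : 3 ≤ d) (hdn : n + 1 ≤ d)
    (len : Fin m → Fin (d - 3) → ℕ) (hpos : ∀ i j, 1 ≤ len i j)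
    (hinj : ∀ i, Function.Injective (len i)) :
    Nonempty ((rigidification K G P len).aut ≃* G) ∧
      Nonempty ((rigidification K G P len).realization ≃ₕ K.realization) := by
  exact ⟨⟨(MulEquiv.ofBijective (Rigid.actHom P len) ⟨Rigid.actHom_injective,
    Rigid.actHom_surjective hm hPsurj hG hpos hinj⟩).symm⟩, Rigid.homotopyEquiv hP⟩
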